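/- \textbf{Definitions.} A \emph{vectoid} is a (locally small) category $\mathcal A$ with an associative, commutative and unital tensor product $\otimes$ (a symmetric monoidal category) such that: (V1) all small colimits exist in $\mathcal A$; (V2) $\otimes$ preserves small colimits in each argument; (V3) finite limits exist in $\mathcal A$; (V4) every pullback of an epimorphism (in particular every epimorphism) is the coequalizer of its kernel pair, and every equivalence relation $R\subset X\times X$ coincides with $X\times_{X/R}X$; (V5) $\mathcal A$ has a small family of generators; (V6) every presheaf of sets $\mathcal A^{op}\to\mathrm{Sets}$ which transforms small colimits of $\mathcal A$ into limits is representable. A \emph{$\otimes$-functor} is a functor $F$ with isomorphisms $FX\otimes FY\cong F(X\otimes Y)$, $\mathbf 1\cong F\mathbf 1$ compatible with the associativity, commutativity and unity constraints; morphisms of $\otimes$-functors are the monoidal natural transformations. A \emph{morphism of vectoids} $f:\mathcal A\to\mathcal B$ is a pair of adjoint functors $f^*\dashv f_*$, $f^*:\mathcal B\to\mathcal A$, $f_*:\mathcal A\to\mathcal B$, with $f^*$ a $\otimes$-functor; $\mathrm{Hom}(\mathcal A,\mathcal B)$ is the category of these, a morphism $f\to g$ being a morphism $f^*\to g^*$ of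 $\otimes$-functors. An \emph{object classifier} is a vectoid $\mathcal C$ with an object $X_{\mathcal C}$ such that for every vectoid $\mathcal A$ the functor $\mathrm{Hom}(\mathcal A,\mathcal C)\to\mathcal A$, $f\mapsto f^*X_{\mathcal C}$, is an equivalence of categories. Let $N_{iso}$ be the groupoid of the standard finite sets $\mathbf n=\{1,\dots,n\}$, $n\ge 0$, and their bijections, with the symmetric monoidal structure given by disjoint union, $\mathbf m\sqcup\mathbf n\cong\mathbf{m+n}$ (the elements of $\mathbf m$ preceding those of $\mathbf n$). Let $\mathcal Q_o=\widehat{N_{iso}}$ be the category of presheaves of sets on $N_{iso}$ with the induced Day convolution tensor product, and let $X_o=h_{\mathbf 1}$ be the presheaf represented by $\mathbf 1$. For a presheaf $F$ put $F_n=F(\mathbf n)$, a set with a right action of the symmetric group $S_n$. \textbf{Theorem.} $(\mathcal Q_o,X_o)$ is an object classifier; in particular, $\mathcal Q_o$ is a vectoid. Moreover, let $\mathcal A$ be any vectoid. Then evaluation at $X_o$ is an equivalence from the category of cocontinuous $\otimes$-functors $\mathcal Q_o\to\mathcal A$ onto $\mathcal A$. For every object $X$ of $\mathcal A$ there is exactly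 one family of actions of the groups $S_n$ on the tensor powers $X^{\otimes n}$ ($n\ge 0$) in which the transposition of two neighbours acts by the commutativity constraint on the corresponding two factors; and there are a cocontinuous $\otimes$-functor $\bar\Phi_X:\mathcal Q_o\to\mathcal A$ and an isomorphism $e:\bar\Phi_X(X_o)\cong X$ such that for any cocontinuous $\otimes$-functor $\Psi:\mathcal Q_o\to\mathcal A$ with an isomorphism $e':\Psi(X_o)\cong X$ there is a unique isomorphism of $\otimes$-functors $\theta:\bar\Phi_X\cong\Psi$ with $e'\circ\theta_{X_o}=e$. As a functor, $\bar\Phi_X$ is given by $$\bar\Phi_X(F)\;\cong\;\bigsqcup_{n\ge 0}\,(F_n\otimes X^{\otimes n})/S_n ,$$ naturally in $F$, where $F_n\otimes X^{\otimes n}$ is the coproduct of copies of $X^{\otimes n}$ indexed by $F_n$, and the quotient is taken by the diagonal action $\sigma\cdot(a\otimes x)=a\sigma^{-1}\otimes\sigma x$. -/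

import Mathlib

open CategoryTheory MonoidalCategory Limits Opposite

universe u v w

namespace Vectoids

/-! ### The groupoid of standard finite sets and bijections -/

/-- The objects of `Niso`: the natural number `n` stands for the standard `n`-element set, here
`Fin n`. -/
structure Niso : Type where
  /-- the number of elements -/
  n : ℕ

namespace Niso

/-- The morphisms of `Niso` are the bijections. -/
structure Hom (m k : Niso) : Type where
  /-- the underlying bijection -/
  equiv : Fin m.n ≃ Fin k.n

instance : Category.{0} Niso where
  Hom := Hom
  id m := ⟨Equiv.refl _⟩
  comp f g := ⟨f.equiv.trans g.equiv⟩

theorem hom_ext {m k : Niso} {f g : m ⟶ k} (h : ∀ i, f.equiv i = g.equiv i) : f = g := by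
  obtain ⟨f⟩ := f
  obtain ⟨g⟩ := g
  exact congrArg Hom.mk (Equiv.ext h)

/-- A bijection, as an isomorphism. -/
def isoMk {m k : Niso} (e : Fin m.n ≃ Fin k.n) : m ≅ k where
  hom := ⟨e⟩
  inv := ⟨e.symm⟩
  hom_inv_id := hom_ext fun i => e.symm_apply_apply i
  inv_hom_id := hom_ext fun i => e.apply_symm_apply i

/-- The disjoint union of two bijections. Disjoint unions `{1,…,a} ⊔ {1,…,b}` are identified with
`{1,…,a+b}` by `finSumFinEquiv`: the elements of the first set precede those of the second. -/
def sumMap {a b c d : ℕ} (f : Fin a ≃ Fin c) (g : Fin b ≃ Fin d) : Fin (a + b) ≃ Fin (c + d) :=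
  finSumFinEquiv.symm.trans ((Equiv.sumCongr f g).trans finSumFinEquiv)

/-- `(a ⊔ b) ⊔ c ≃ a ⊔ (b ⊔ c)` -/
def sumAssoc (a b c : ℕ) : Fin (a + b + c) ≃ Fin (a + (b + c)) :=
  (finSumFinEquiv.symm.trans (Equiv.sumCongr finSumFinEquiv.symm (Equiv.refl _))).trans
    ((Equiv.sumAssoc _ _ _).trans
      ((Equiv.sumCongr (Equiv.refl _) finSumFinEquiv).trans finSumFinEquiv))

/-- `∅ ⊔ a ≃ a` -/
def zeroSum (a : ℕ) : Fin (0 + a) ≃ Fin a :=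
  finSumFinEquiv.symm.trans (Equiv.emptySum (Fin 0) (Fin a))

/-- `a ⊔ ∅ ≃ a` -/
def sumZero (a : ℕ) : Fin (a + 0) ≃ Fin a :=
  finSumFinEquiv.symm.trans (Equiv.sumEmpty (Fin a) (Fin 0))

/-- `a ⊔ b ≃ b ⊔ a`, exchanging the two summands -/
def sumComm (a b : ℕ) : Fin (a + b) ≃ Fin (b + a) :=
  finSumFinEquiv.symm.trans ((Equiv.sumComm _ _).trans finSumFinEquiv)

section
variable {a b c d : ℕ} (f : Fin a ≃ Fin c) (g : Fin b ≃ Fin d)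
@[simp] theorem sumMap_left (i : Fin a) : sumMap f g (i.castAdd b) = (f i).castAdd d := by
  simp [sumMap]
@[simp] theorem sumMap_right (i : Fin b) : sumMap f g (i.natAdd a) = (g i).natAdd c := by
  simp [sumMap]
@[simp] theorem sumAssoc_1 (i : Fin a) :
    sumAssoc a b c ((i.castAdd b).castAdd c) = i.castAdd (b + c) := by simp [sumAssoc]
@[simp] theorem sumAssoc_2 (i : Fin b) :
    sumAssoc a b c ((i.natAdd a).castAdd c) = (i.castAdd c).natAdd a := by simp [sumAssoc]
@[simp] theorem sumAssoc_3 (i : Fin c) :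
    sumAssoc a b c (i.natAdd (a + b)) = (i.natAdd b).natAdd a := by simp [sumAssoc]
@[simp] theorem zeroSum_right (i : Fin a) : zeroSum a (i.natAdd 0) = i := by
  rw [zeroSum, Equiv.trans_apply, finSumFinEquiv_symm_apply_natAdd]; rfl
@[simp] theorem sumZero_left (i : Fin a) : sumZero a (i.castAdd 0) = i := by
  rw [sumZero, Equiv.trans_apply, finSumFinEquiv_symm_apply_castAdd]; rfl
@[simp] theorem sumComm_left (i : Fin a) : sumComm a b (i.castAdd b) = i.natAdd b := by
  simp [sumComm]
@[simp] theorem sumComm_right (i : Fin b) : sumComm a b (i.natAdd a) = i.castAdd a := by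
  simp [sumComm]
theorem equiv_ext {n : ℕ} {e e' : Fin (a + b) ≃ Fin n}
    (h₁ : ∀ i : Fin a, e (i.castAdd b) = e' (i.castAdd b))
    (h₂ : ∀ i : Fin b, e (i.natAdd a) = e' (i.natAdd a)) : e = e' :=
  Equiv.ext fun i => Fin.addCases h₁ h₂ i

theorem equiv_ext₃ {n : ℕ} {e e' : Fin (a + b + c) ≃ Fin n}
    (h₁ : ∀ i : Fin a, e ((i.castAdd b).castAdd c) = e' ((i.castAdd b).castAdd c))
    (h₂ : ∀ i : Fin b, e ((i.natAdd a).castAdd c) = e' ((i.natAdd a).castAdd c))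
    (h₃ : ∀ i : Fin c, e (i.natAdd (a + b)) = e' (i.natAdd (a + b))) : e = e' :=
  equiv_ext (fun i => Fin.addCases h₁ h₂ i) h₃
end

section
variable {a b c a' b' c' a'' b'' : ℕ}

theorem sumMap_refl : sumMap (Equiv.refl (Fin a)) (Equiv.refl (Fin b)) = Equiv.refl _ :=
  equiv_ext (by simp) (by simp)

theorem sumMap_trans (f : Fin a ≃ Fin a') (g : Fin b ≃ Fin b') (f' : Fin a' ≃ Fin a'')
    (g' : Fin b' ≃ Fin b'') :
    (sumMap f g).trans (sumMap f' g') = sumMap (f.trans f') (g.trans g') :=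
  equiv_ext (by simp) (by simp)

theorem sumAssoc_nat (f : Fin a ≃ Fin a') (g : Fin b ≃ Fin b') (h : Fin c ≃ Fin c') :
    (sumMap (sumMap f g) h).trans (sumAssoc a' b' c') =
      (sumAssoc a b c).trans (sumMap f (sumMap g h)) :=
  equiv_ext₃ (by simp) (by simp) (by simp)

theorem zeroSum_nat (f : Fin a ≃ Fin a') :
    (sumMap (Equiv.refl (Fin 0)) f).trans (zeroSum a') = (zeroSum a).trans f :=
  equiv_ext (fun i => i.elim0) fun i => by
    rw [Equiv.trans_apply, Equiv.trans_apply, sumMap_right, zeroSum_right, zeroSum_right]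

theorem sumZero_nat (f : Fin a ≃ Fin a') :
    (sumMap f (Equiv.refl (Fin 0))).trans (sumZero a') = (sumZero a).trans f :=
  equiv_ext (fun i => by
    rw [Equiv.trans_apply, Equiv.trans_apply, sumMap_left, sumZero_left, sumZero_left])
    (fun i => i.elim0)

theorem sum_pentagon (a b c d : ℕ) :
    (sumMap (sumAssoc a b c) (Equiv.refl (Fin d))).trans
      ((sumAssoc a (b + c) d).trans (sumMap (Equiv.refl (Fin a)) (sumAssoc b c d))) =
    (sumAssoc (a + b) c d).trans (sumAssoc a b (c + d)) :=
  equiv_ext (fun i => Fin.addCases (fun i => Fin.addCases (by simp) (by simp) i) (by simp) i)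
    (by simp)

theorem sum_triangle (a b : ℕ) :
    (sumAssoc a 0 b).trans (sumMap (Equiv.refl (Fin a)) (zeroSum b)) =
      sumMap (sumZero a) (Equiv.refl (Fin b)) :=
  equiv_ext₃
    (fun i => by
      rw [Equiv.trans_apply, sumAssoc_1, sumMap_left, sumMap_left, sumZero_left, Equiv.refl_apply])
    (fun i => i.elim0)
    (fun i => by
      rw [Equiv.trans_apply, sumAssoc_3, sumMap_right, sumMap_right, zeroSum_right,
        Equiv.refl_apply])

theorem sumComm_nat (f : Fin a ≃ Fin a') (g : Fin b ≃ Fin b') :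
    (sumMap f g).trans (sumComm a' b') = (sumComm a b).trans (sumMap g f) :=
  equiv_ext (by simp) (by simp)

theorem sumComm_symm (a b : ℕ) : (sumComm a b).trans (sumComm b a) = Equiv.refl _ :=
  equiv_ext (by simp) (by simp)

theorem sum_hexagon (a b c : ℕ) :
    (sumAssoc a b c).trans ((sumComm a (b + c)).trans (sumAssoc b c a)) =
      (sumMap (sumComm a b) (Equiv.refl (Fin c))).trans
        ((sumAssoc b a c).trans (sumMap (Equiv.refl (Fin b)) (sumComm a c))) :=
  equiv_ext₃ (by simp) (by simp) (by simp)

theorem sum_hexagon' (a b c : ℕ) :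
    (sumAssoc a b c).symm.trans ((sumComm (a + b) c).trans (sumAssoc c a b).symm) =
      (sumMap (Equiv.refl (Fin a)) (sumComm b c)).trans
        ((sumAssoc a c b).symm.trans (sumMap (sumComm a c) (Equiv.refl (Fin b)))) := by
  have h₁ := sum_hexagon c a b
  apply_fun Equiv.symm at h₁
  have hc : ∀ m n, (sumComm m n).symm = sumComm n m := fun m n =>
    Equiv.ext fun i => (Equiv.symm_apply_eq _).2 (congrFun (congrArg DFunLike.coe (sumComm_symm n m)) i).symm
  simp only [Equiv.symm_trans, hc, Equiv.trans_assoc] at h₁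
  have hs : ∀ {p q r s : ℕ} (f : Fin p ≃ Fin r) (g : Fin q ≃ Fin s),
    (sumMap f g).symm = sumMap f.symm g.symm := fun f g => Equiv.ext fun i => by
      simp [sumMap]
  simp only [hs, hc, Equiv.refl_symm] at h₁
  exact h₁
end

/-- The tensor product on `Niso` is the disjoint union. -/
instance : MonoidalCategoryStruct Niso where
  tensorObj m k := ⟨m.n + k.n⟩
  tensorUnit := ⟨0⟩
  tensorHom f g := ⟨sumMap f.equiv g.equiv⟩
  whiskerLeft m _ _ g := ⟨sumMap (Equiv.refl (Fin m.n)) g.equiv⟩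
  whiskerRight f k := ⟨sumMap f.equiv (Equiv.refl (Fin k.n))⟩
  associator a b c := isoMk (sumAssoc a.n b.n c.n)
  leftUnitor a := isoMk (zeroSum a.n)
  rightUnitor a := isoMk (sumZero a.n)

instance : MonoidalCategory Niso where
  tensorHom_def f g := congrArg Hom.mk (sumMap_trans f.equiv (Equiv.refl _) (Equiv.refl _) g.equiv).symm
  id_tensorHom_id _ _ := congrArg Hom.mk sumMap_refl
  tensorHom_comp_tensorHom f g f' g' :=
    congrArg Hom.mk (sumMap_trans f.equiv g.equiv f'.equiv g'.equiv)
  whiskerLeft_id _ _ := congrArg Hom.mk sumMap_refl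
  id_whiskerRight _ _ := congrArg Hom.mk sumMap_refl
  associator_naturality f g h := congrArg Hom.mk (sumAssoc_nat f.equiv g.equiv h.equiv)
  leftUnitor_naturality f := congrArg Hom.mk (zeroSum_nat f.equiv)
  rightUnitor_naturality f := congrArg Hom.mk (sumZero_nat f.equiv)
  pentagon a b c d := congrArg Hom.mk (sum_pentagon a.n b.n c.n d.n)
  triangle a b := congrArg Hom.mk (sum_triangle a.n b.n)

instance : SymmetricCategory Niso where
  braiding a b := isoMk (sumComm a.n b.n)
  braiding_naturality_right a _ _ f :=
    congrArg Hom.mk (sumComm_nat (Equiv.refl (Fin a.n)) f.equiv)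
  braiding_naturality_left f a :=
    congrArg Hom.mk (sumComm_nat f.equiv (Equiv.refl (Fin a.n)))
  hexagon_forward a b c := congrArg Hom.mk (sum_hexagon a.n b.n c.n)
  hexagon_reverse a b c := congrArg Hom.mk (sum_hexagon' a.n b.n c.n)
  symmetry a b := congrArg Hom.mk (sumComm_symm a.n b.n)
end Niso

instance : SymmetricCategory Nisoᵒᵖ where
  symmetry X Y := Quiver.Hom.unop_inj (SymmetricCategory.symmetry X.unop Y.unop)

/-! ### Presheaves on `Niso` with the Day convolution -/

/-- Presheaves of sets on `Niso`. The type synonym `DayFunctor` carries the monoidal structure given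
by Day convolution, i.e. `F ⊗ G` is the left Kan extension of `(m, k) ↦ F m × G k` along the tensor
product of `Nisoᵒᵖ`. -/
abbrev Qo : Type (u+1) := DayFunctor Nisoᵒᵖ (Type u)
namespace Qo
open LawfulDayConvolutionMonoidalCategoryStruct DayFunctor
attribute [local instance] convolution convolution₂ convolution₂'

/-- The braiding of the Day convolution. -/
noncomputable def braidingIso (F G : Qo.{u}) : F ⊗ G ≅ G ⊗ F where
  hom := ⟨(DayConvolution.braiding
      ((ι Nisoᵒᵖ (Type u) Qo.{u}).obj F) ((ι Nisoᵒᵖ (Type u) Qo.{u}).obj G)).hom⟩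
  inv := ⟨(DayConvolution.braiding
      ((ι Nisoᵒᵖ (Type u) Qo.{u}).obj F) ((ι Nisoᵒᵖ (Type u) Qo.{u}).obj G)).inv⟩
  hom_inv_id := hom_ext (Iso.hom_inv_id _)
  inv_hom_id := hom_ext (Iso.inv_hom_id _)

theorem ι_braiding (F G : Qo.{u}) : (ι Nisoᵒᵖ (Type u) Qo.{u}).map (braidingIso F G).hom =
    (DayConvolution.braiding
      ((ι Nisoᵒᵖ (Type u) Qo.{u}).obj F) ((ι Nisoᵒᵖ (Type u) Qo.{u}).obj G)).hom := rfl

theorem ι_whiskerLeft (F : Qo.{u}) {G H : Qo.{u}} (f : G ⟶ H) :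
    (ι Nisoᵒᵖ (Type u) Qo.{u}).map (F ◁ f) =
      DayConvolution.map (𝟙 ((ι Nisoᵒᵖ (Type u) Qo.{u}).obj F)) ((ι Nisoᵒᵖ (Type u) Qo.{u}).map f) := by
  rw [← id_tensorHom, ι_map_tensorHom_hom_eq_tensorHom, CategoryTheory.Functor.map_id]

theorem ι_whiskerRight {G H : Qo.{u}} (f : G ⟶ H) (F : Qo.{u}) :
    (ι Nisoᵒᵖ (Type u) Qo.{u}).map (f ▷ F) =
      DayConvolution.map ((ι Nisoᵒᵖ (Type u) Qo.{u}).map f) (𝟙 ((ι Nisoᵒᵖ (Type u) Qo.{u}).obj F)) := by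
  rw [← tensorHom_id, ι_map_tensorHom_hom_eq_tensorHom, CategoryTheory.Functor.map_id]

theorem ι_associator_inv (F G H : Qo.{u}) :
    (ι Nisoᵒᵖ (Type u) Qo.{u}).map (α_ F G H).inv =
    (DayConvolution.associator ((ι Nisoᵒᵖ (Type u) Qo.{u}).obj F) ((ι Nisoᵒᵖ (Type u) Qo.{u}).obj G)
      ((ι Nisoᵒᵖ (Type u) Qo.{u}).obj H)).inv := by
  rw [← cancel_epi ((ι Nisoᵒᵖ (Type u) Qo.{u}).map (α_ F G H).hom), ← Functor.map_comp,
    Iso.hom_inv_id, CategoryTheory.Functor.map_id, ι_map_associator_hom_eq_associator_hom]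
  exact (Iso.hom_inv_id _).symm

noncomputable instance : SymmetricCategory Qo.{u} where
  braiding := braidingIso
  braiding_naturality_right F G H f := (ι Nisoᵒᵖ (Type u) Qo.{u}).map_injective (by
    rw [Functor.map_comp, Functor.map_comp, ι_braiding, ι_braiding, ι_whiskerLeft, ι_whiskerRight]
    exact DayConvolution.braiding_naturality_right _ _)
  braiding_naturality_left f F := (ι Nisoᵒᵖ (Type u) Qo.{u}).map_injective (by
    rw [Functor.map_comp, Functor.map_comp, ι_braiding, ι_braiding, ι_whiskerLeft, ι_whiskerRight]
    exact DayConvolution.braiding_naturality_left _ _)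
  hexagon_forward F G H := (ι Nisoᵒᵖ (Type u) Qo.{u}).map_injective (by
    simp only [Functor.map_comp, ι_braiding, ι_whiskerLeft, ι_whiskerRight,
      ι_map_associator_hom_eq_associator_hom]
    exact DayConvolution.hexagon_forward _ _ _)
  hexagon_reverse F G H := (ι Nisoᵒᵖ (Type u) Qo.{u}).map_injective (by
    simp only [Functor.map_comp, ι_braiding, ι_whiskerLeft, ι_whiskerRight,
      ι_associator_inv]
    exact DayConvolution.hexagon_reverse _ _ _)
  symmetry F G := (ι Nisoᵒᵖ (Type u) Qo.{u}).map_injective (by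
    rw [Functor.map_comp, ι_braiding, ι_braiding, CategoryTheory.Functor.map_id]
    exact DayConvolution.symmetry _ _)
end Qo

/-- The universal object: the presheaf represented by the one-element set. -/
def Xo : Qo.{u} := ⟨uliftYoneda.{u}.obj (⟨1⟩ : Niso)⟩

/-! ### Vectoids -/

/-- `f` is the cokernel (coequalizer) of its kernel pair. -/
def IsCokernelOfKernelPair {A : Type v} [Category.{u} A] {X Y : A} (f : X ⟶ Y) : Prop :=
  ∀ ⦃R : A⦄ (p₁ p₂ : R ⟶ X) (h : IsKernelPair f p₁ p₂), Nonempty (IsColimit (Cofork.ofπ f h.w))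

/-- Prevectoids. The tensor structure is associative, commutative and unital; "small" means
`u`-small, where `u` is the universe of the sets of morphisms. -/
class IsPrevectoid (A : Type v) [Category.{u} A] [MonoidalCategory A] [SymmetricCategory A] :
    Prop where
  /-- V1: arbitrary small colimits exist. -/
  hasColimits : HasColimits A
  /-- V2: the tensor product preserves colimits in the second argument ... -/
  preservesColimits_tensorLeft (X : A) : PreservesColimits (tensorLeft X)
  /-- ... and in the first. -/
  preservesColimits_tensorRight (X : A) : PreservesColimits (tensorRight X)
  /-- V3: finite limits exist. -/
  hasFiniteLimits : HasFiniteLimits A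
  /-- V4: every pullback `f'` of an epimorphism `f` (in particular `f` itself) is the cokernel of its
  kernel pair. -/
  epi_universally_effective ⦃X Y X' Y' : A⦄ (g' : X' ⟶ X) (f' : X' ⟶ Y') (f : X ⟶ Y) (g : Y' ⟶ Y) :
    Epi f → IsPullback g' f' f g → IsCokernelOfKernelPair f'
  /-- V4: an equivalence relation on `X` with quotient `π : X ⟶ Q` is the fibre product of `π` with
  itself. -/
  equivalenceRelation_effective ⦃R X Q : A⦄ (p₁ p₂ : R ⟶ X) (π : X ⟶ Q) (hπ : p₁ ≫ π = p₂ ≫ π) :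
    IsEquivalenceRelation p₁ p₂ → Nonempty (IsColimit (Cofork.ofπ π hπ)) → IsKernelPair π p₁ p₂
  /-- V5: there is a small family of generators. -/
  exists_generators : ∃ (ι : Type u) (G : ι → A), (ObjectProperty.ofObj G).IsSeparating

/-- Vectoids: prevectoids which satisfy the completeness (totality) axiom V6, every presheaf of sets
which transforms small colimits into limits is representable. -/
class IsVectoid (A : Type v) [Category.{u} A] [MonoidalCategory A] [SymmetricCategory A] : Prop
    extends IsPrevectoid A where
  isRepresentable (F : Aᵒᵖ ⥤ Type u) : PreservesLimits F → F.IsRepresentable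

attribute [instance] IsPrevectoid.hasColimits

/-! ### Tensor functors and morphisms of vectoids -/

section TensorFunctor

variable (B : Type w) [Category.{u} B] [MonoidalCategory B] [SymmetricCategory B]
  (A : Type v) [Category.{u} A] [MonoidalCategory A] [SymmetricCategory A]

/-- `⊗`-functors: functors with isomorphisms `F X ⊗ F Y ≅ F (X ⊗ Y)` and `𝟙 ≅ F 𝟙` compatible with
the associativity, unity and commutativity constraints. -/
structure TensorFunctor where
  /-- the underlying functor -/
  functor : B ⥤ A
  /-- the tensor structure -/
  braided : functor.Braided

attribute [instance] TensorFunctor.braided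

variable {B A} in
/-- Morphisms of `⊗`-functors: natural transformations compatible with the tensor structures. -/
@[ext]
structure TensorFunctor.Hom (F G : TensorFunctor B A) where
  /-- the underlying natural transformation -/
  natTrans : F.functor ⟶ G.functor
  /-- it is monoidal -/
  isMonoidal : NatTrans.IsMonoidal natTrans

attribute [instance] TensorFunctor.Hom.isMonoidal

instance : Category (TensorFunctor B A) where
  Hom := TensorFunctor.Hom
  id F := ⟨𝟙 F.functor, inferInstance⟩
  comp f g := ⟨f.natTrans ≫ g.natTrans, inferInstance⟩
  id_comp f := TensorFunctor.Hom.ext (Category.id_comp f.natTrans)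
  comp_id f := TensorFunctor.Hom.ext (Category.comp_id f.natTrans)
  assoc f g h := TensorFunctor.Hom.ext (Category.assoc f.natTrans g.natTrans h.natTrans)

/-- Cocontinuous `⊗`-functors. -/
structure CocontTensorFunctor extends TensorFunctor B A where
  /-- small colimits are preserved -/
  cocontinuous : PreservesColimits functor

instance : Category (CocontTensorFunctor B A) where
  Hom F G := F.toTensorFunctor ⟶ G.toTensorFunctor
  id F := 𝟙 F.toTensorFunctor
  comp {F G H} (f : F.toTensorFunctor ⟶ G.toTensorFunctor)
    (g : G.toTensorFunctor ⟶ H.toTensorFunctor) := f ≫ g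
  id_comp {F G} (f : F.toTensorFunctor ⟶ G.toTensorFunctor) := Category.id_comp f
  comp_id {F G} (f : F.toTensorFunctor ⟶ G.toTensorFunctor) := Category.comp_id f
  assoc {F G H K} (f : F.toTensorFunctor ⟶ G.toTensorFunctor)
    (g : G.toTensorFunctor ⟶ H.toTensorFunctor)
    (h : H.toTensorFunctor ⟶ K.toTensorFunctor) := Category.assoc f g h

variable {B} in
/-- Evaluation of cocontinuous `⊗`-functors and of their morphisms at an object. -/
def CocontTensorFunctor.eval (X : B) : CocontTensorFunctor B A ⥤ A where
  obj F := F.functor.obj X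
  map {F G} (f : F.toTensorFunctor ⟶ G.toTensorFunctor) := f.natTrans.app X

end TensorFunctor

section VectoidHom

variable (A : Type v) [Category.{u} A] [MonoidalCategory A] [SymmetricCategory A]
  (B : Type w) [Category.{u} B] [MonoidalCategory B] [SymmetricCategory B]

/-- Morphisms from the vectoid `A` to the vectoid `B`: pairs of adjoint functors `f^* : B ⥤ A`,
`f_* : A ⥤ B`, where `f^*` is a `⊗`-functor. -/
structure VectoidHom where
  /-- the inverse image functor `f^*` -/
  inverseImage : TensorFunctor B A
  /-- the direct image functor `f_*` -/
  directImage : A ⥤ B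
  /-- the adjunction -/
  adjunction : inverseImage.functor ⊣ directImage

/-- A 2-morphism `f ⟶ g` is a morphism `f^* ⟶ g^*` of `⊗`-functors. -/
instance : Category (VectoidHom A B) where
  Hom f g := f.inverseImage ⟶ g.inverseImage
  id f := 𝟙 f.inverseImage
  comp {f g h} (a : f.inverseImage ⟶ g.inverseImage) (b : g.inverseImage ⟶ h.inverseImage) := a ≫ b
  id_comp {f g} (a : f.inverseImage ⟶ g.inverseImage) := Category.id_comp a
  comp_id {f g} (a : f.inverseImage ⟶ g.inverseImage) := Category.comp_id a
  assoc {f g h k} (a : f.inverseImage ⟶ g.inverseImage) (b : g.inverseImage ⟶ h.inverseImage)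
    (c : h.inverseImage ⟶ k.inverseImage) := Category.assoc a b c

variable {B} in
/-- The inverse image `f ↦ f^* X` of an object `X` of the target. -/
def VectoidHom.inverseImageOf (X : B) : VectoidHom A B ⥤ A where
  obj f := f.inverseImage.functor.obj X
  map {f g} (a : f.inverseImage ⟶ g.inverseImage) := a.natTrans.app X

end VectoidHom

/-- The pair `(C, X)` is an object classifier: `C` is a vectoid and `X` an object of it, such that for
every vectoid `A` the functor `Hom(A, C) ⥤ A`, `f ↦ f^* X`, is an equivalence of categories. -/
def IsObjectClassifier (C : Type w) [Category.{u} C] [MonoidalCategory C] [SymmetricCategory C]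
    (X : C) : Prop :=
  IsVectoid C ∧
    ∀ (A : Type v) [Category.{u} A] [MonoidalCategory A] [SymmetricCategory A] [IsVectoid A],
      (VectoidHom.inverseImageOf A X).IsEquivalence

/-! ### Tensor powers and the explicit formula -/

section Powers

variable {A : Type v} [Category.{u} A] [MonoidalCategory A] [SymmetricCategory A]

/-- The tensor power `X^{⊗n}`, bracketed from the left. -/
def tensorPow (X : A) : ℕ → A
  | 0 => 𝟙_ A
  | n + 1 => tensorPow X n ⊗ X

/-- The automorphism of `X^{⊗(n+1)}` which exchanges the neighbouring factors number `i` and `i + 1`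
by means of the commutativity constraint (`0 ≤ i < n`, the factors being numbered from `0`). -/
def exchange (X : A) : (n : ℕ) → Fin n → (tensorPow X (n + 1) ⟶ tensorPow X (n + 1))
  | 0 => fun i => i.elim0
  | n + 1 => Fin.lastCases
      ((α_ (tensorPow X n) X X).hom ≫ tensorPow X n ◁ (β_ X X).hom ≫ (α_ (tensorPow X n) X X).inv)
      fun i => exchange X n i ▷ X

/-- The left actions of the symmetric groups on the tensor powers of `X` by permutation of the
factors. They are determined by the images of the transpositions of neighbours, because these
generate the symmetric groups. -/
structure PermutationAction (X : A) where
  /-- the action of the symmetric group on `X^{⊗n}` -/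
  act (n : ℕ) : Equiv.Perm (Fin n) →* End (tensorPow X n)
  /-- transpositions of neighbours act by the commutativity constraint -/
  act_swap (n : ℕ) (i : Fin n) : act (n + 1) (Equiv.swap i.castSucc i.succ) = exchange X n i

variable [HasColimits A] {X : A} (ρ : PermutationAction X)

/-- The value of a presheaf on the standard `n`-element set. -/
abbrev Qo.level (F : Qo.{u}) (n : ℕ) : Type u := F.functor.obj (op (⟨n⟩ : Niso))

/-- The right action of the symmetric group on `F_n`. -/
def Qo.rightAct (F : Qo.{u}) {n : ℕ} (a : F.level n) (σ : Equiv.Perm (Fin n)) : F.level n :=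
  F.functor.map (Quiver.Hom.op (⟨σ⟩ : (⟨n⟩ : Niso) ⟶ ⟨n⟩)) a

theorem Qo.rightAct_one (F : Qo.{u}) {n : ℕ} (a : F.level n) : F.rightAct a 1 = a :=
  congrArg (fun f => f a) (F.functor.map_id (op (⟨n⟩ : Niso)))

theorem Qo.rightAct_mul (F : Qo.{u}) {n : ℕ} (a : F.level n) (σ τ : Equiv.Perm (Fin n)) :
    F.rightAct a (σ * τ) = F.rightAct (F.rightAct a σ) τ :=
  congrArg (fun f => f a) (F.functor.map_comp (Quiver.Hom.op (⟨σ⟩ : (⟨n⟩ : Niso) ⟶ ⟨n⟩))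
    (Quiver.Hom.op (⟨τ⟩ : (⟨n⟩ : Niso) ⟶ ⟨n⟩)))

/-- `F_n ⊗ X^{⊗n}`: the coproduct of copies of `X^{⊗n}` indexed by the set `F_n`. -/
noncomputable abbrev copower (X : A) (F : Qo.{u}) (n : ℕ) : A :=
  ∐ fun _ : F.level n => tensorPow X n

/-- The diagonal action on `F_n ⊗ X^{⊗n}`: `σ` maps the copy of `X^{⊗n}` number `a` to the copy number
`a σ⁻¹`, by means of the action of `σ` on `X^{⊗n}`. -/
noncomputable def diagonalAct (F : Qo.{u}) (n : ℕ) :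
    Equiv.Perm (Fin n) →* End (copower X F n) where
  toFun σ := Sigma.desc fun a =>
    (ρ.act n σ : tensorPow X n ⟶ tensorPow X n) ≫
      Sigma.ι (fun _ : F.level n => tensorPow X n) (F.rightAct a σ⁻¹)
  map_one' := by
    refine Sigma.hom_ext _ _ fun a => ?_
    rw [Sigma.ι_desc, inv_one, Qo.rightAct_one, map_one, End.one_def, End.one_def,
      Category.id_comp, Category.comp_id]
  map_mul' σ τ := by
    refine Sigma.hom_ext _ _ fun a => ?_
    rw [Sigma.ι_desc, End.mul_def, Sigma.ι_desc_assoc, Category.assoc, Sigma.ι_desc, mul_inv_rev,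
      Qo.rightAct_mul, map_mul, End.mul_def, Category.assoc]

/-- `(F_n ⊗ X^{⊗n}) / S_n`: the quotient (colimit) of `F_n ⊗ X^{⊗n}` by the diagonal action. -/
noncomputable abbrev quotient (F : Qo.{u}) (n : ℕ) : A :=
  colimit (SingleObj.functor (diagonalAct ρ F n))

theorem Qo.app_rightAct {F G : Qo.{u}} (f : F ⟶ G) {n : ℕ} (a : F.level n)
    (σ : Equiv.Perm (Fin n)) :
    f.natTrans.app (op ⟨n⟩) (F.rightAct a σ) =
      Qo.rightAct G (f.natTrans.app (op (⟨n⟩ : Niso)) a) σ :=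
  congrArg (fun g => g a) (f.natTrans.naturality (Quiver.Hom.op (⟨σ⟩ : (⟨n⟩ : Niso) ⟶ ⟨n⟩)))

/-- The map `F_n ⊗ X^{⊗n} ⟶ G_n ⊗ X^{⊗n}` induced by a map of presheaves. -/
noncomputable def copowerMap (X : A) {F G : Qo.{u}} (f : F ⟶ G) (n : ℕ) :
    copower X F n ⟶ copower X G n :=
  Limits.Sigma.desc fun a : F.level n => Sigma.ι (fun _ : G.level n => tensorPow X n)
    (f.natTrans.app (op ⟨n⟩) a)

set_option linter.unusedSectionVars false in
theorem copowerMap_id (X : A) (F : Qo.{u}) (n : ℕ) : copowerMap X (𝟙 F) n = 𝟙 _ := by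
  refine Sigma.hom_ext _ _ fun a => ?_
  rw [copowerMap, Sigma.ι_desc, Category.comp_id]
  rfl

set_option linter.unusedSectionVars false in
theorem copowerMap_comp (X : A) {F G H : Qo.{u}} (f : F ⟶ G) (g : G ⟶ H) (n : ℕ) :
    copowerMap X (f ≫ g) n = copowerMap X f n ≫ copowerMap X g n := by
  refine Sigma.hom_ext _ _ fun a => ?_
  rw [copowerMap, copowerMap, copowerMap, Sigma.ι_desc, Sigma.ι_desc_assoc, Sigma.ι_desc]
  rfl

theorem diagonalAct_copowerMap {F G : Qo.{u}} (f : F ⟶ G) (n : ℕ) (σ : Equiv.Perm (Fin n)) :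
    (diagonalAct ρ F n σ : copower X F n ⟶ copower X F n) ≫ copowerMap X f n =
      copowerMap X f n ≫ (diagonalAct ρ G n σ : copower X G n ⟶ copower X G n) := by
  refine Sigma.hom_ext _ _ fun a => ?_
  simp only [copowerMap, diagonalAct, MonoidHom.coe_mk, OneHom.coe_mk, Sigma.ι_desc_assoc,
    Category.assoc, Sigma.ι_desc, Qo.app_rightAct]

/-- The diagonal action on `F_n ⊗ X^{⊗n}` is functorial in the presheaf `F`. -/
noncomputable def diagonalActMap {F G : Qo.{u}} (f : F ⟶ G) (n : ℕ) :
    SingleObj.functor (diagonalAct ρ F n) ⟶ SingleObj.functor (diagonalAct ρ G n) :=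
  SingleObj.natTrans (copowerMap X f n) (diagonalAct_copowerMap ρ f n)

/-- The functor `F ↦ ∐_n (F_n ⊗ X^{⊗n}) / S_n`. -/
noncomputable def explicitFunctor : Qo.{u} ⥤ A where
  obj F := ∐ fun n : ℕ => quotient ρ F n
  map f := Limits.Sigma.map fun n => colimMap (diagonalActMap ρ f n)
  map_id F := by
    refine Sigma.hom_ext _ _ fun n => ?_
    rw [Limits.Sigma.ι_map, Category.comp_id]
    have : colimMap (diagonalActMap ρ (𝟙 F) n) = 𝟙 (quotient ρ F n) := colimit.hom_ext fun _ => by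
      rw [ι_colimMap, Category.comp_id]
      exact (congrArg (fun t => t ≫ _) (copowerMap_id X F n)).trans (Category.id_comp _)
    rw [this, Category.id_comp]
  map_comp {F G H} f g := by
    refine Sigma.hom_ext _ _ fun n => ?_
    rw [Limits.Sigma.ι_map, Limits.Sigma.ι_map_assoc, Limits.Sigma.ι_map, ← Category.assoc]
    congr 1
    refine colimit.hom_ext fun _ => ?_
    rw [ι_colimMap, ι_colimMap_assoc, ι_colimMap, ← Category.assoc]
    exact congrArg (fun t => t ≫ _) (copowerMap_comp X f g n)

end Powers

end Vectoids

open Vectoids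

/-!
The groupoid `Niso` of finite sets is the free symmetric monoidal category on one object, and
`Qo` is its free cocompletion as a monoidal category. A cocontinuous `⊗`-functor on `Qo` therefore
amounts to a symmetric monoidal functor on `Niso`, and such a functor to an object.

Free symmetric monoidal category. The tensor powers of an object `X` form a functor on `Niso`: a
bijection acts by inserting the last factor at its place, after a bijection of the remaining
points has permuted the remaining factors (`powMap`). Functoriality is reduced by induction to the
independence of two insertions of their order (`insertLast_comm`), a consequence of the
Yang–Baxter relation. The functor is symmetric monoidal; compatibility with the braiding only has
to be verified for `X ⊗ X`, since both hexagons propagate it (`IsBraidedAt.tensor`). The actions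
of the symmetric groups are unique because the transpositions of neighbours generate them
(`eq_powAction`). A map `G 1 ⟶ H 1` between the values of symmetric monoidal functors extends
uniquely to a monoidal transformation (`extend`, `monoidal_natTrans_ext`): the components are
forced, and their naturality has to be checked on the same generators only.

Free cocompletion. The Yoneda embedding `Qo.y` is symmetric monoidal. A cocontinuous functor on
`Qo` has a right adjoint, so that maps out of its values are determined by elements of presheaves.
Hence transformations of cocontinuous functors are determined by, and extend from, their
restrictions to the representable presheaves (`Qo.cocontinuous_natTrans_ext`,
`Qo.exists_extension`), and monoidality and invertibility can be tested there. Together with the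
first part this proves that evaluation at the universal object is bijective on morphisms
(`eval_bijective`).

The explicit functor `F ↦ ∐_n (F_n ⊗ X^{⊗n}) / S_n` is left adjoint to `Y ↦ (n ↦ Hom(X^{⊗n}, Y))`,
so it is cocontinuous. Maps out of its values are given on elements, which defines an oplax tensor
structure and proves its coherence. The comparison maps are isomorphisms because they are so for
representable presheaves. This functor takes the universal object to `X`, so that evaluation is
essentially surjective.

That `Qo` is a vectoid is verified on elements, except for the representability axiom, which
follows from the adjoint functor theorem for presheaves.
-/

set_option linter.unusedSectionVars false

namespace Vectoids
namespace Qo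
open DayFunctor LawfulDayConvolutionMonoidalCategoryStruct

/-! ### Elements of presheaves and of their Day convolutions -/

section Elements

variable {F G H K : Qo.{u}} {x y z x' y' : Nisoᵒᵖ}

/-- The value of a presheaf at an object. -/
abbrev val (F : Qo.{u}) (x : Nisoᵒᵖ) : Type u := F.functor.obj x

/-- The restriction of an element of a presheaf along a morphism of `Nisoᵒᵖ`. -/
abbrev res (F : Qo.{u}) (f : x ⟶ y) (a : F.val x) : F.val y := F.functor.map f a

/-- The action of a morphism of presheaves on elements. -/
abbrev ap (f : F ⟶ G) (a : F.val x) : G.val x := f.natTrans.app x a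

/-- The element `a ⊗ b` of `(F ⊗ G) (x ⊗ y)`. -/
noncomputable def tmul (a : F.val x) (b : G.val y) : (F ⊗ G).val (x ⊗ y) :=
  (η F G).app (x, y) (a, b)

/-- The canonical element of the unit object. -/
noncomputable def one : (𝟙_ Qo.{u}).val (𝟙_ Nisoᵒᵖ) := ν Nisoᵒᵖ (Type u) PUnit.unit

theorem res_tmul (f : x ⟶ x') (g : y ⟶ y') (a : F.val x) (b : G.val y) :
    res (F ⊗ G) (f ⊗ₘ g) (tmul a b) = tmul (res F f a) (res G g b) :=
  (congrArg (fun t => t (a, b)) ((η F G).naturality (show (x, y) ⟶ (x', y') from (f, g)))).symm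

theorem ap_tensorHom (f : F ⟶ H) (g : G ⟶ K) (a : F.val x) (b : G.val y) :
    ap (f ⊗ₘ g) (tmul a b) = tmul (ap f a) (ap g b) :=
  congrArg (fun t => t (a, b))
    (convolutionExtensionUnit_comp_ι_map_tensorHom_app (C := Nisoᵒᵖ) (V := Type u) f g x y)

theorem ap_associator (a : F.val x) (b : G.val y) (c : H.val z) :
    ap (α_ F G H).hom (tmul (tmul a b) c) =
      res (F ⊗ (G ⊗ H)) (α_ x y z).inv (tmul a (tmul b c)) :=
  congrArg (fun t => t ((a, b), c)) (associator_hom_unit_unit (C := Nisoᵒᵖ) (Type u) F G H x y z)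

theorem ap_leftUnitor (a : F.val x) :
    ap (λ_ F).hom (tmul one a) = res F (λ_ x).inv a :=
  congrArg (fun t => t (PUnit.unit, a))
    (leftUnitor_hom_unit_app (C := Nisoᵒᵖ) (Type u) F x)

theorem ap_rightUnitor (a : F.val x) :
    ap (ρ_ F).hom (tmul a one) = res F (ρ_ x).inv a :=
  congrArg (fun t => t (a, PUnit.unit))
    (rightUnitor_hom_unit_app (C := Nisoᵒᵖ) (Type u) F x)

attribute [local instance] convolution in
theorem ap_braiding (a : F.val x) (b : G.val y) :
    ap (β_ F G).hom (tmul a b) = res (G ⊗ F) (β_ y x).hom (tmul b a) :=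
  congrArg (fun t => t (a, b)) (DayConvolution.unit_app_braiding_hom_app
    ((ι Nisoᵒᵖ (Type u) Qo.{u}).obj F) ((ι Nisoᵒᵖ (Type u) Qo.{u}).obj G) x y)

theorem hom_ext' {f g : F ⟶ G} (h : ∀ x (a : F.val x), ap f a = ap g a) : f = g := by
  ext x a
  exact h x a

/-- A morphism out of a Day convolution is determined by its values at the elements `a ⊗ b`,
although these elements do not exhaust it. -/
theorem tensor_ext {f g : F ⊗ G ⟶ H}
    (h : ∀ x y (a : F.val x) (b : G.val y), ap f (tmul a b) = ap g (tmul a b)) : f = g :=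
  tensor_hom_ext fun x y => by
    ext ⟨a, b⟩
    exact h x y a b

theorem unit_ext {f g : 𝟙_ Qo.{u} ⟶ F} (h : ap f one = ap g one) : f = g :=
  unit_hom_ext (by ext; exact h)

theorem ap_res (f : F ⟶ G) (t : x ⟶ y) (a : F.val x) :
    ap f (res F t a) = res G t (ap f a) :=
  congrArg (fun s => s a) (f.natTrans.naturality t)

@[simp] theorem ap_comp (f : F ⟶ G) (g : G ⟶ H) (a : F.val x) : ap (f ≫ g) a = ap g (ap f a) := rfl
@[simp] theorem ap_id (a : F.val x) : ap (𝟙 F) a = a := rfl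
theorem res_comp (f : x ⟶ y) (g : y ⟶ z) (a : F.val x) :
    res F (f ≫ g) a = res F g (res F f a) := congrArg (fun s => s a) (F.functor.map_comp f g)
theorem res_id (a : F.val x) : res F (𝟙 x) a = a := congrArg (fun s => s a) (F.functor.map_id x)

theorem ap_whiskerLeft (f : G ⟶ K) (a : F.val x) (b : G.val y) :
    ap (F ◁ f) (tmul a b) = tmul a (ap f b) := by
  rw [← id_tensorHom, ap_tensorHom, ap_id]

theorem ap_whiskerRight (f : F ⟶ K) (a : F.val x) (b : G.val y) :
    ap (f ▷ G) (tmul a b) = tmul (ap f a) b := by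
  rw [← tensorHom_id, ap_tensorHom, ap_id]

/-- A morphism out of `F ⊗ G`, given by its values on the elements `a ⊗ b`. -/
noncomputable def lift (φ : ∀ x y, F.val x → G.val y → H.val (x ⊗ y))
    (hφ : ∀ {x x' y y'} (f : x ⟶ x') (g : y ⟶ y') a b,
      φ x' y' (res F f a) (res G g b) = res H (f ⊗ₘ g) (φ x y a b)) : F ⊗ G ⟶ H :=
  tensorDesc
    { app := fun p => ↾fun q => φ p.1 p.2 q.1 q.2
      naturality := fun p q f => by
        ext ⟨a, b⟩
        exact hφ f.1 f.2 a b }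

theorem ap_lift (φ : ∀ x y, F.val x → G.val y → H.val (x ⊗ y)) (hφ) (a : F.val x) (b : G.val y) :
    ap (lift φ hφ) (tmul a b) = φ x y a b :=
  congrArg (fun t => t (a, b)) (η_comp_tensorDesc_app (F := F) (G := G) (H := H) _ x y)

end Elements
end Qo
namespace Qo
open DayFunctor

/-! ### The Yoneda embedding is a symmetric monoidal functor -/

/-- The Yoneda embedding of `Niso` into presheaves. -/
def y : Niso ⥤ Qo.{u} where
  obj n := ⟨uliftYoneda.{u}.obj n⟩
  map f := ⟨uliftYoneda.{u}.map f⟩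

/-- The universal element of a representable presheaf. -/
def univ (n : Niso) : (y.{u}.obj n).val (op n) := ULift.up (𝟙 n)

variable {F G H : Qo.{u}}

/-- The morphism out of a representable presheaf which corresponds to an element. -/
def yhom {n : Niso} (a : F.val (op n)) : y.{u}.obj n ⟶ F where
  natTrans :=
    { app := fun _ => ↾fun f => res F f.down.op a
      naturality := fun _ _ t => by
        ext f
        exact res_comp f.down.op t a }

theorem ap_yhom {n : Niso} (a : F.val (op n)) : ap (yhom a) (univ n) = a := res_id a

theorem ap_yhom' {n : Niso} (a : F.val (op n)) {x} (f : (y.{u}.obj n).val x) :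
    ap (yhom a) f = res F f.down.op a := rfl

theorem eq_res_univ {n : Niso} {x} (f : (y.{u}.obj n).val x) :
    f = res _ f.down.op (univ n) := by
  obtain ⟨f⟩ := f
  exact congrArg ULift.up (Category.comp_id f).symm

/-- The uniqueness part of the Yoneda lemma. -/
theorem y_ext {n : Niso} {f g : y.{u}.obj n ⟶ F} (h : ap f (univ n) = ap g (univ n)) : f = g :=
  hom_ext' fun x a => by
    rw [eq_res_univ a, ap_res, ap_res, h]

theorem ap_y_map {m n : Niso} (f : m ⟶ n) :
    ap (y.{u}.map f) (univ m) = res _ f.op (univ n) :=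
  congrArg ULift.up ((Category.id_comp f).trans (Category.comp_id f).symm)

/-- The comparison `h_{m ⊔ n} ⟶ h_m ⊗ h_n`. -/
noncomputable def yδ (m n : Niso) : y.{u}.obj (m ⊗ n) ⟶ y.obj m ⊗ y.obj n :=
  yhom (tmul (univ m) (univ n))

/-- The comparison `h_0 ⟶ 𝟙`. -/
noncomputable def yη : y.{u}.obj (𝟙_ Niso) ⟶ 𝟙_ Qo.{u} := yhom one

theorem ap_yδ (m n : Niso) : ap (yδ.{u} m n) (univ (m ⊗ n)) = tmul (univ m) (univ n) := ap_yhom _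

theorem ap_yη : ap yη.{u} (univ (𝟙_ Niso)) = one := ap_yhom _

theorem ap_yδ_res {m n : Niso} {x} (f : op (m ⊗ n) ⟶ x) :
    ap (yδ.{u} m n) (res _ f (univ (m ⊗ n))) = res _ f (tmul (univ m) (univ n)) := by
  rw [ap_res, ap_yδ]

theorem ap_leftUnitor_inv {x} (a : F.val x) :
    ap (λ_ F).inv a = res _ (λ_ x).hom (tmul one a) := by
  have h : a = ap (λ_ F).hom (res _ (λ_ x).hom (tmul one a)) := by
    rw [ap_res, ap_leftUnitor, ← res_comp, Iso.inv_hom_id, res_id]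
  conv_lhs => rw [h]
  rw [← ap_comp, Iso.hom_inv_id, ap_id]

theorem ap_rightUnitor_inv {x} (a : F.val x) :
    ap (ρ_ F).inv a = res _ (ρ_ x).hom (tmul a one) := by
  have h : a = ap (ρ_ F).hom (res _ (ρ_ x).hom (tmul a one)) := by
    rw [ap_res, ap_rightUnitor, ← res_comp, Iso.inv_hom_id, res_id]
  conv_lhs => rw [h]
  rw [← ap_comp, Iso.hom_inv_id, ap_id]

theorem tmul_res_left {x x' z} (f : x ⟶ x') (a : F.val x) (b : G.val z) :
    tmul (res F f a) b = res _ (f ▷ z) (tmul a b) := by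
  rw [← tensorHom_id, res_tmul, res_id]

theorem tmul_res_right {x x' z} (f : x ⟶ x') (a : F.val z) (b : G.val x) :
    tmul a (res G f b) = res _ (z ◁ f) (tmul a b) := by
  rw [← id_tensorHom, res_tmul, res_id]

/-- The oplax monoidal structure of the Yoneda embedding; its axioms are identities between images
of universal elements. -/
@[reducible]
noncomputable def yOplaxMonoidal : y.{u}.OplaxMonoidal where
  η := yη
  δ := yδ
  δ_natural_left f n := y_ext (by
    rw [ap_comp, ap_comp, ap_yδ, ap_whiskerRight, ap_y_map, ap_y_map, ap_yδ_res, tmul_res_left]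
    rfl)
  δ_natural_right n f := y_ext (by
    rw [ap_comp, ap_comp, ap_yδ, ap_whiskerLeft, ap_y_map, ap_y_map, ap_yδ_res, tmul_res_right]
    rfl)
  oplax_associativity m n k := y_ext (by
    rw [ap_comp, ap_comp, ap_comp, ap_comp, ap_yδ, ap_whiskerRight, ap_yδ, ap_associator, ap_y_map,
      ap_yδ_res, ap_res, ap_whiskerLeft, ap_yδ]
    rfl)
  oplax_left_unitality n := y_ext (by
    rw [ap_comp, ap_comp, ap_y_map, ap_yδ_res, ap_res, ap_whiskerRight, ap_yη, ap_leftUnitor_inv]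
    rfl)
  oplax_right_unitality n := y_ext (by
    rw [ap_comp, ap_comp, ap_y_map, ap_yδ_res, ap_res, ap_whiskerLeft, ap_yη, ap_rightUnitor_inv]
    rfl)

/-- The morphism of `Niso` which an element of a representable presheaf is. -/
def toHom {n : Niso} {x} (a : (y.{u}.obj n).val x) : unop x ⟶ n := a.down

/-- A morphism of `Niso`, as an element of a representable presheaf. -/
def ofHom {n : Niso} {x} (a : unop x ⟶ n) : (y.{u}.obj n).val x := ULift.up a

theorem eq_res_toHom {n : Niso} {x} (a : (y.{u}.obj n).val x) :
    a = res _ (toHom a).op (univ n) := eq_res_univ a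

instance (m n : Niso) : IsIso (yδ.{u} m n) := by
  refine ⟨lift (fun p q a b => ofHom (x := p ⊗ q) (toHom a ⊗ₘ toHom b)) ?_, y_ext ?_, tensor_ext ?_⟩
  · rintro p p' q q' f g ⟨a⟩ ⟨b⟩
    exact congrArg ULift.up (tensorHom_comp_tensorHom f.unop g.unop a b).symm
  · rw [ap_comp, ap_yδ, ap_lift]
    exact congrArg ULift.up (id_tensorHom_id m n)
  · rintro p q a b
    rw [ap_comp, ap_lift, ap_id, yδ, ap_yhom']
    conv_rhs => rw [eq_res_toHom a, eq_res_toHom b, ← res_tmul]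
    rfl

/-- The inverse of `yη`. -/
noncomputable def yε : 𝟙_ Qo.{u} ⟶ y.{u}.obj (𝟙_ Niso) :=
  unitDesc (↾fun _ => univ (𝟙_ Niso))

theorem ap_yε : ap yε.{u} one = univ (𝟙_ Niso) := by
  have h := ν_comp_unitDesc (F := y.{u}.obj (𝟙_ Niso)) (↾fun _ => univ (𝟙_ Niso))
  exact ConcreteCategory.congr_hom h PUnit.unit

instance : IsIso yη.{u} := by
  refine ⟨yε, y_ext ?_, unit_ext ?_⟩
  · rw [ap_comp, ap_yη]
    exact ap_yε
  · rw [ap_comp, ap_yε]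
    exact ap_yη

noncomputable instance : y.{u}.Monoidal :=
  letI := yOplaxMonoidal.{u}
  haveI : IsIso (Functor.OplaxMonoidal.η y.{u}) := inferInstanceAs (IsIso yη)
  haveI (m n : Niso) : IsIso (Functor.OplaxMonoidal.δ y.{u} m n) := inferInstanceAs (IsIso (yδ m n))
  .ofOplaxMonoidal _

theorem δ_y (m n : Niso) : Functor.OplaxMonoidal.δ y.{u} m n = yδ m n := rfl

noncomputable instance : y.{u}.Braided where
  braided m n := by
    rw [← cancel_epi (Functor.OplaxMonoidal.δ y.{u} m n), Functor.Monoidal.δ_μ_assoc,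
      ← cancel_mono (Functor.OplaxMonoidal.δ y.{u} n m), Category.assoc, Category.assoc,
      Functor.Monoidal.μ_δ, Category.comp_id, δ_y, δ_y]
    refine y_ext ?_
    rw [ap_comp, ap_comp, ap_y_map, ap_yδ_res, ap_yδ, ap_braiding]
    rfl

end Qo
namespace Qo
open DayFunctor

/-! ### Presheaves on `Niso` form a vectoid -/

/-- `Qo` is equivalent to the category of functors `Nisoᵒᵖ ⥤ Type u`. -/
abbrev equivFunctor : Qo.{u} ≌ (Nisoᵒᵖ ⥤ Type u) := DayFunctor.equiv _ _

instance : HasColimits Qo.{u} := Adjunction.has_colimits_of_equivalence equivFunctor.functor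

instance : HasFiniteLimits Qo.{u} where
  out _ _ _ := Adjunction.hasLimitsOfShape_of_equivalence equivFunctor.functor

section Closed

/-- The shifted presheaf `x ↦ H (x ⊗ z)`. -/
abbrev shift (H : Qo.{u}) (z : Nisoᵒᵖ) : Qo.{u} := ⟨tensorRight z ⋙ H.functor⟩

/-- The map between shifted presheaves which is induced by a morphism of `Nisoᵒᵖ`. -/
abbrev shiftMap (H : Qo.{u}) {z z' : Nisoᵒᵖ} (f : z ⟶ z') : shift H z ⟶ shift H z' :=
  ⟨Functor.whiskerRight ((curriedTensor Nisoᵒᵖ).flip.map f) H.functor⟩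

/-- The internal Hom of presheaves with respect to the Day convolution. -/
def ihomObj (F H : Qo.{u}) : Qo.{u} where
  functor :=
    { obj z := F ⟶ shift H z
      map f := ↾fun φ => φ ≫ shiftMap H f
      map_id z := ConcreteCategory.hom_ext _ _ fun φ => hom_ext' fun x a => by
        change res H (x ◁ 𝟙 z) (ap (G := shift H z) φ a) = ap (G := shift H z) φ a
        rw [whiskerLeft_id, res_id]
      map_comp f g := ConcreteCategory.hom_ext _ _ fun φ => hom_ext' fun x a => by
        change res H (x ◁ (f ≫ g)) (ap (G := shift H _) φ a) =
          res H (x ◁ g) (res H (x ◁ f) (ap (G := shift H _) φ a))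
        rw [whiskerLeft_comp, res_comp] }

/-- The evaluation of an element of the internal Hom. -/
def ihomEval {F H : Qo.{u}} {x z : Nisoᵒᵖ} (φ : (ihomObj F H).val z) (a : F.val x) :
    H.val (x ⊗ z) :=
  (DayFunctor.Hom.natTrans (show F ⟶ shift H z from φ)).app x a

theorem ihomEval_res {F H : Qo.{u}} {x z z'} (t : z ⟶ z') (φ : (ihomObj F H).val z)
    (a : F.val x) : ihomEval (res (ihomObj F H) t φ) a = res H (x ◁ t) (ihomEval φ a) := rfl

theorem ihomEval_res_arg {F H : Qo.{u}} {x x' z} (t : x ⟶ x') (φ : (ihomObj F H).val z)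
    (a : F.val x) : ihomEval φ (res F t a) = res H (t ▷ z) (ihomEval φ a) :=
  ap_res (show F ⟶ shift H z from φ) t a

theorem ihom_ext {F H : Qo.{u}} {z} {φ ψ : (ihomObj F H).val z}
    (h : ∀ x (a : F.val x), ihomEval φ a = ihomEval ψ a) : φ = ψ :=
  hom_ext' (F := F) (G := shift H z) h

/-- An element of the internal Hom, given by its values. -/
def ihomMk {F H : Qo.{u}} {z : Nisoᵒᵖ} (φ : ∀ x, F.val x → H.val (x ⊗ z))
    (hφ : ∀ {x x'} (t : x ⟶ x') a, φ x' (res F t a) = res H (t ▷ z) (φ x a)) :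
    (ihomObj F H).val z :=
  show F ⟶ shift H z from
    { natTrans :=
        { app x := ↾(φ x)
          naturality _ _ t := ConcreteCategory.hom_ext _ _ fun a => hφ t a } }

/-- Currying, from morphisms `F ⊗ G ⟶ H`. -/
noncomputable def tensorCurry {F G H : Qo.{u}} (f : F ⊗ G ⟶ H) : G ⟶ ihomObj F H where
  natTrans :=
    { app z := ↾fun b => ihomMk (fun x a => ap f (tmul a b)) fun t a => by
        rw [tmul_res_left, ap_res]
      naturality z z' t := ConcreteCategory.hom_ext _ _ fun b => ihom_ext fun x a => by
        change ap f (tmul a (res G t b)) = res H (x ◁ t) (ap f (tmul a b))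
        rw [tmul_res_right, ap_res] }

theorem ihomEval_tensorCurry {F G H : Qo.{u}} (f : F ⊗ G ⟶ H) {x z} (a : F.val x) (b : G.val z) :
    ihomEval (ap (tensorCurry f) b) a = ap f (tmul a b) := rfl

/-- Currying. -/
noncomputable def tensorHomEquiv (F G H : Qo.{u}) : (F ⊗ G ⟶ H) ≃ (G ⟶ ihomObj F H) where
  toFun := tensorCurry
  invFun g := lift (fun x z a b => ihomEval (ap g b) a) (by
    intro x x' z z' t s a b
    rw [ap_res g, MonoidalCategory.tensorHom_def, res_comp, ihomEval_res, ihomEval_res_arg])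
  left_inv f := tensor_ext fun x z a b => by rw [ap_lift, ihomEval_tensorCurry]
  right_inv g := hom_ext' fun z b => ihom_ext fun x a => by rw [ihomEval_tensorCurry, ap_lift]

/-- The Day convolution is closed. -/
noncomputable def tensorLeftAdjunction (F : Qo.{u}) :
    tensorLeft F ⊣ Adjunction.rightAdjointOfEquiv (F := tensorLeft F) (tensorHomEquiv F) (by
      intro G' G H g h
      exact hom_ext' fun z b => ihom_ext fun x a => congrArg (ap h) (ap_whiskerLeft g a b)) :=
  Adjunction.adjunctionOfEquivRight _ _

instance (F : Qo.{u}) : PreservesColimits (tensorLeft F) :=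
  (tensorLeftAdjunction F).leftAdjoint_preservesColimits

instance (F : Qo.{u}) : PreservesColimits (tensorRight F) :=
  preservesColimits_of_natIso (BraidedCategory.tensorLeftIsoTensorRight F)

end Closed

section Exact

variable {F G H R X Y : Qo.{u}}

/-- Epimorphisms of presheaves are surjective on elements, since evaluation at an object preserves
colimits. -/
theorem surjective_of_epi (f : X ⟶ Y) [Epi f] (n : Nisoᵒᵖ) (b : Y.val n) :
    ∃ a : X.val n, ap f a = b := by
  have : Epi (equivFunctor.functor.map f) := inferInstance
  have : Epi ((equivFunctor.functor.map f).app n) := inferInstance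
  exact (epi_iff_surjective _).1 this b

/-- Pullbacks of presheaves are computed on elements. By the Yoneda lemma, a compatible pair of
elements is a cone from a representable presheaf. -/
theorem IsPullback.exists_element {P Z : Qo.{u}} {p₁ : P ⟶ X} {p₂ : P ⟶ Y} {f : X ⟶ Z} {g : Y ⟶ Z}
    (h : IsPullback p₁ p₂ f g) {n : Nisoᵒᵖ} (a : X.val n) (b : Y.val n) (hab : ap f a = ap g b) :
    ∃ r : P.val n, ap p₁ r = a ∧ ap p₂ r = b := by
  have w : yhom (n := unop n) a ≫ f = yhom (n := unop n) b ≫ g :=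
    y_ext (by rw [ap_comp, ap_comp, ap_yhom, ap_yhom]; exact hab)
  refine ⟨ap (h.lift _ _ w) (univ (unop n)), ?_, ?_⟩
  · rw [← ap_comp, h.lift_fst, ap_yhom]
  · rw [← ap_comp, h.lift_snd, ap_yhom]

/-- The map out of `Y` is defined on an element by means of an arbitrary preimage; the kernel pair
shows that the choice does not matter. -/
theorem isCokernelOfKernelPair_of_surjective (f : X ⟶ Y)
    (hf : ∀ n (b : Y.val n), ∃ a : X.val n, ap f a = b) : IsCokernelOfKernelPair f := by
  intro R p₁ p₂ h
  choose s hs using hf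
  have key : ∀ {Z : Qo.{u}} (t : X ⟶ Z), p₁ ≫ t = p₂ ≫ t → ∀ {n} (a a' : X.val n),
      ap f a = ap f a' → ap t a = ap t a' := by
    intro Z t ht n a a' haa
    obtain ⟨r, rfl, rfl⟩ := IsPullback.exists_element h a a' haa
    exact congrArg (fun q => ap q r) ht
  refine ⟨Cofork.IsColimit.mk' _ fun c => ⟨⟨
    { app n := ↾fun b => ap c.π (s n b)
      naturality n n' t := by
        ext b
        change ap c.π (s n' (res Y t b)) = res _ t (ap c.π (s n b))
        rw [← ap_res]
        exact key c.π c.condition _ _ (by rw [hs, ap_res, hs]) }⟩, ?_, ?_⟩⟩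
  · exact hom_ext' fun n a => key c.π c.condition _ _ (hs n _)
  · intro m hm
    refine hom_ext' fun n b => ?_
    have : ap m (ap f (s n b)) = ap c.π (s n b) := congrArg (fun q => ap q (s n b)) hm
    rwa [hs] at this

/-- Compare the coequalizer with the presheaf of classes of the equivalence relation on elements:
elements with the same image in the former have the same class, hence are related. -/
theorem isKernelPair_of_equivalenceRelation (p₁ p₂ : R ⟶ X) (π : X ⟶ Y) (hπ : p₁ ≫ π = p₂ ≫ π)
    (e : EquivalenceRelation p₁ p₂) (hc : IsColimit (Cofork.ofπ π hπ)) : IsKernelPair π p₁ p₂ := by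
  let rel (n : Nisoᵒᵖ) : Setoid (X.val n) :=
    { r a b := ∃ r : R.val n, ap p₁ r = a ∧ ap p₂ r = b
      iseqv :=
        { refl a := ⟨ap e.r a, congrArg (fun q => ap q a) e.reflexivity₁,
            congrArg (fun q => ap q a) e.reflexivity₂⟩
          symm := by
            rintro _ _ ⟨r, rfl, rfl⟩
            exact ⟨ap e.s r, congrArg (fun q => ap q r) e.symmetry₁,
              congrArg (fun q => ap q r) e.symmetry₂⟩
          trans := by
            rintro _ _ _ ⟨r, rfl, rfl⟩ ⟨r', h, rfl⟩
            obtain ⟨c, rfl, rfl⟩ := IsPullback.exists_element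
              (IsPullback.of_isLimit e.isLimit) r r' h.symm
            exact ⟨ap e.t c, congrArg (fun q => ap q c) e.transitivity₁,
              congrArg (fun q => ap q c) e.transitivity₂⟩ } }
  -- the presheaf of equivalence classes
  let Q : Qo.{u} := ⟨
    { obj n := Quotient (rel n)
      map {n n'} t := ↾(Quotient.map (res X t) (by
        rintro _ _ ⟨r, rfl, rfl⟩
        exact ⟨res R t r, ap_res _ _ _, ap_res _ _ _⟩))
      map_id n := by
        ext a
        induction a using Quotient.inductionOn with | _ a =>
        exact congrArg (Quotient.mk _) (res_id a)
      map_comp f g := by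
        ext a
        induction a using Quotient.inductionOn with | _ a =>
        exact congrArg (Quotient.mk _) (res_comp f g a) }⟩
  let q : X ⟶ Q := ⟨{ app n := ↾(Quotient.mk (rel n)) }⟩
  have hq : p₁ ≫ q = p₂ ≫ q := hom_ext' fun n r => Quotient.sound (s := rel n) ⟨r, rfl, rfl⟩
  have fac : π ≫ hc.desc (Cofork.ofπ q hq) = q := hc.fac (Cofork.ofπ q hq) WalkingParallelPair.one
  have ex : ∀ {n} (a b : X.val n), ap π a = ap π b → ∃ r : R.val n, ap p₁ r = a ∧ ap p₂ r = b := by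
    intro n a b hab
    have : ap q a = ap q b := by rw [← fac, ap_comp, ap_comp, hab]
    exact Quotient.exact (s := rel n) this
  have mono : ∀ {n} (r r' : R.val n), ap p₁ r = ap p₁ r' → ap p₂ r = ap p₂ r' → r = r' := by
    intro n r r' h₁ h₂
    have := e.right_cancellation (yhom (n := unop n) r) (yhom (n := unop n) r')
      (y_ext (by rw [ap_comp, ap_comp, ap_yhom, ap_yhom]; exact h₁))
      (y_ext (by rw [ap_comp, ap_comp, ap_yhom, ap_yhom]; exact h₂))
    have := congrArg (fun t => ap t (univ (unop n))) this
    simp only [ap_yhom] at this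
    exact this
  choose d hd₁ hd₂ using fun n (a b : X.val n) => ex a b
  have hs (s : PullbackCone π π) {n} (a : s.pt.val n) : ap π (ap s.fst a) = ap π (ap s.snd a) :=
    congrArg (fun t => ap t a) s.condition
  refine ⟨⟨hπ⟩, ⟨PullbackCone.IsLimit.mk _ (fun s => ⟨
    { app n := ↾fun a => d n (ap s.fst a) (ap s.snd a) (hs s a)
      naturality n n' t := ConcreteCategory.hom_ext _ _ fun a => ?_ }⟩) ?_ ?_ ?_⟩⟩
  · change d n' (ap s.fst (res _ t a)) (ap s.snd (res _ t a)) (hs s _) =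
      res R t (d n (ap s.fst a) (ap s.snd a) (hs s a))
    refine mono _ _ ?_ ?_
    · rw [hd₁, ap_res, ap_res, hd₁]
    · rw [hd₂, ap_res, ap_res, hd₂]
  · exact fun s => hom_ext' fun n a => hd₁ _ _ _ (hs s a)
  · exact fun s => hom_ext' fun n a => hd₂ _ _ _ (hs s a)
  · intro s m h₁ h₂
    refine hom_ext' fun n a => mono _ _ ?_ ?_
    · exact (congrArg (fun t => ap t a) h₁).trans (hd₁ _ _ _ (hs s a)).symm
    · exact (congrArg (fun t => ap t a) h₂).trans (hd₂ _ _ _ (hs s a)).symm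

end Exact

/-- The adjoint functor theorem for presheaves. The colimits which it uses have index categories
whose sets of morphisms lie in the universe of `Niso`; this accounts for the change of universe
parameters. -/
theorem isLeftAdjoint_of_preservesColimits {A : Type w} [Category.{u} A] [HasColimits A]
    (L : Qo.{u} ⥤ A) [PreservesColimits L] : L.IsLeftAdjoint := by
  have : PreservesColimitsOfSize.{u, u} (equivFunctor.inverse ⋙ L) := inferInstance
  have : PreservesColimitsOfSize.{0, u} (equivFunctor.inverse ⋙ L) :=
    preservesColimitsOfSize_of_univLE.{u, u} (equivFunctor.inverse ⋙ L)
  have : HasColimitsOfSize.{0, u} A := hasColimitsOfSizeOfUnivLE.{u, u} A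
  have := Presheaf.isLeftAdjoint_of_preservesColimits.{u} (equivFunctor.inverse ⋙ L)
  exact Functor.isLeftAdjoint_of_iso (equivFunctor.funInvIdAssoc L)

/-- A presheaf on `Qo` which transforms colimits into limits is a cocontinuous functor from `Qo`
to the opposite of the category of sets. It has a right adjoint, whose value at a point represents
the presheaf. -/
theorem isRepresentable (F : Qo.{u}ᵒᵖ ⥤ Type u) [PreservesLimits F] : F.IsRepresentable := by
  have : PreservesColimits F.rightOp := preservesColimits_rightOp F
  have := isLeftAdjoint_of_preservesColimits F.rightOp
  let adj := Adjunction.ofIsLeftAdjoint F.rightOp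
  refine Functor.RepresentableBy.isRepresentable (Y := F.rightOp.rightAdjoint.obj (op PUnit)) ?_
  exact
    { homEquiv {X} := (adj.homEquiv X (op PUnit)).symm.trans
        ((opEquiv _ _).trans ⟨fun f => f PUnit.unit, fun a => ↾fun _ => a,
          fun f => by ext; rfl, fun a => rfl⟩)
      homEquiv_comp {X X'} f g := by
        have h := adj.homEquiv_naturality_left_symm f g
        exact congrArg (fun t : F.rightOp.obj X ⟶ op PUnit => t.unop PUnit.unit) h }

instance : IsVectoid Qo.{u} where
  hasColimits := inferInstance
  preservesColimits_tensorLeft _ := inferInstance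
  preservesColimits_tensorRight _ := inferInstance
  hasFiniteLimits := inferInstance
  epi_universally_effective X Y X' Y' g' f' f g hf h :=
    isCokernelOfKernelPair_of_surjective f' fun n b => by
      obtain ⟨a, ha⟩ := surjective_of_epi f n (ap g b)
      obtain ⟨r, -, hr⟩ := IsPullback.exists_element h a b ha
      exact ⟨r, hr⟩
  equivalenceRelation_effective R X Q p₁ p₂ π hπ h hc :=
    isKernelPair_of_equivalenceRelation p₁ p₂ π hπ h.nonempty_equivalenceRelation.some hc.some
  exists_generators := ⟨ULift.{u} Niso, fun n => y.obj n.down, fun X Y f g h =>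
    hom_ext' fun n a => by
      have := h _ (ObjectProperty.ofObj_apply _ (ULift.up (unop n))) (yhom (n := unop n) a)
      have := congrArg (fun t => ap t (univ (unop n))) this
      simp only [ap_comp, ap_yhom] at this
      exact this⟩
  isRepresentable F _ := isRepresentable F

end Qo

/-! ### Bijections of standard finite sets with a point removed -/

namespace Niso

/-- The bijection `Fin m ≃ Fin n` which `f` induces on the complements of a point `p` and of its
image `f p`; the complements are numbered in increasing order. -/
def del {m n : ℕ} (f : Fin (m + 1) ≃ Fin (n + 1)) (p : Fin (m + 1)) : Fin m ≃ Fin n :=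
  (finSuccAboveEquiv p).trans ((f.subtypeEquiv (p := (· ≠ p)) (q := (· ≠ f p))
    fun _ => f.injective.ne_iff.symm).trans (finSuccAboveEquiv (f p)).symm)

theorem succAbove_del {m n : ℕ} (f : Fin (m + 1) ≃ Fin (n + 1)) (p : Fin (m + 1)) (i : Fin m) :
    (f p).succAbove (del f p i) = f (p.succAbove i) := by
  have := (finSuccAboveEquiv (f p)).apply_symm_apply
    (f.subtypeEquiv (p := (· ≠ p)) (q := (· ≠ f p)) (fun _ => f.injective.ne_iff.symm)
      (finSuccAboveEquiv p i))
  exact congrArg Subtype.val this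

theorem del_eq {m n : ℕ} {f : Fin (m + 1) ≃ Fin (n + 1)} {p : Fin (m + 1)} {g : Fin m ≃ Fin n}
    (h : ∀ i, (f p).succAbove (g i) = f (p.succAbove i)) : del f p = g :=
  Equiv.ext fun i => Fin.succAbove_right_injective ((succAbove_del f p i).trans (h i).symm)

theorem del_refl {m : ℕ} (p : Fin (m + 1)) : del (Equiv.refl _) p = Equiv.refl _ :=
  del_eq fun _ => rfl

theorem del_trans {m n k : ℕ} (f : Fin (m + 1) ≃ Fin (n + 1)) (g : Fin (n + 1) ≃ Fin (k + 1))
    (p : Fin (m + 1)) : del (f.trans g) p = (del f p).trans (del g (f p)) :=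
  del_eq fun i => by
    rw [Equiv.trans_apply, Equiv.trans_apply, Equiv.trans_apply, succAbove_del, succAbove_del]

/-- Inserting `b` after `a`, or `d` after `c`, into `n` points gives the same numbering of these
`n` points, if the two ways insert the same two points. -/
theorem succAbove_succAbove_comm {n : ℕ} {a c : Fin (n + 1)} {b d : Fin (n + 2)}
    (h₁ : b.succAbove a = d) (h₂ : d.succAbove c = b) (i : Fin n) :
    b.succAbove (a.succAbove i) = d.succAbove (c.succAbove i) := by
  subst h₁
  simp only [Fin.succAbove, Fin.lt_def, Fin.ext_iff] at *
  split_ifs at * <;> simp at * <;> omega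

/-- The same two points can be removed in either order. -/
theorem del_del {m n : ℕ} (g : Fin (m + 2) ≃ Fin (n + 2)) (q : Fin (m + 1)) :
    del (del g q.castSucc) (Fin.last m) = del (del g (Fin.last (m + 1))) q := by
  have h₁ := succAbove_del g (Fin.last _) q
  have h₂ := succAbove_del g q.castSucc (Fin.last m)
  rw [Fin.succAbove_last] at h₁
  rw [Fin.succAbove_castSucc_of_le _ _ (Fin.le_last q), Fin.succ_last] at h₂
  refine del_eq fun i => Fin.succAbove_right_injective (p := g q.castSucc) ?_
  rw [← succAbove_succAbove_comm h₁ h₂, succAbove_del, succAbove_del, succAbove_del]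
  congr 1
  rw [Fin.succAbove_last, Fin.succAbove_last]
  simp only [Fin.succAbove, Fin.lt_def, Fin.ext_iff]
  split_ifs <;> simp at * <;> omega

end Niso

/-! ### Permutations of the factors of a tensor power -/

section Powers

variable {A : Type v} [Category.{u} A] [MonoidalCategory A] [SymmetricCategory A]

/-- The exchange of the last two factors of `(T ⊗ X) ⊗ X`. -/
def swapLast (T X : A) : (T ⊗ X) ⊗ X ⟶ (T ⊗ X) ⊗ X :=
  (α_ T X X).hom ≫ T ◁ (β_ X X).hom ≫ (α_ T X X).inv

theorem swapLast_swapLast (T X : A) : swapLast T X ≫ swapLast T X = 𝟙 _ := by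
  simp [swapLast, ← whiskerLeft_comp_assoc]

theorem swapLast_naturality {T T' : A} (f : T ⟶ T') (X : A) :
    f ▷ X ▷ X ≫ swapLast T' X = swapLast T X ≫ f ▷ X ▷ X := by
  simp only [swapLast, Category.assoc, associator_naturality_left_assoc]
  rw [← whisker_exchange_assoc, associator_inv_naturality_left]

/-- The Yang–Baxter relation for the last three factors. -/
theorem swapLast_braid (T X : A) :
    swapLast (T ⊗ X) X ≫ swapLast T X ▷ X ≫ swapLast (T ⊗ X) X =
      swapLast T X ▷ X ≫ swapLast (T ⊗ X) X ≫ swapLast T X ▷ X := by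
  have h := BraidedCategory.yang_baxter' X X X
  calc
    _ = 𝟙 (((T ⊗ X) ⊗ X) ⊗ X) ⊗≫ T ◁ (𝟙 ((X ⊗ X) ⊗ X) ⊗≫
          (X ◁ (β_ X X).hom ⊗≫ (β_ X X).hom ▷ X ⊗≫ X ◁ (β_ X X).hom) ⊗≫ 𝟙 ((X ⊗ X) ⊗ X)) ⊗≫
        𝟙 (((T ⊗ X) ⊗ X) ⊗ X) := by
      simp only [swapLast]
      monoidal
    _ = _ := by
      rw [← h]
      simp only [swapLast]
      monoidal

variable (X : A)

/-- The defining isomorphism `X^{⊗(n+1)} ≅ X^{⊗n} ⊗ X`. It is an identity, but it is kept explicit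
so that the types of the composites below agree syntactically. -/
def powSucc (n : ℕ) : tensorPow X (n + 1) ≅ tensorPow X n ⊗ X := Iso.refl (tensorPow X n ⊗ X)

/-- The insertion of the last factor of `X^{⊗n} ⊗ X` at position `p`: it is moved to the left past
one factor after another, by means of the braiding. -/
def insertLast : (n : ℕ) → Fin (n + 1) → (tensorPow X n ⊗ X ⟶ tensorPow X (n + 1))
  | 0 => fun _ => (powSucc X 0).inv
  | n + 1 => Fin.lastCases (powSucc X (n + 1)).inv fun q =>
      (powSucc X n).hom ▷ X ≫ swapLast _ X ≫ insertLast n q ▷ X ≫ (powSucc X (n + 1)).inv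

theorem insertLast_last (n : ℕ) : insertLast X n (Fin.last n) = (powSucc X n).inv := by
  cases n with
  | zero => rfl
  | succ n =>
    rw [insertLast]
    exact Fin.lastCases_last

theorem insertLast_castSucc (n : ℕ) (q : Fin (n + 1)) :
    insertLast X (n + 1) q.castSucc =
      (powSucc X n).hom ▷ X ≫ swapLast _ X ≫ insertLast X n q ▷ X ≫ (powSucc X (n + 1)).inv := by
  rw [insertLast]
  exact Fin.lastCases_castSucc _

/-- Two insertions can be carried out in either order. This is the only consequence of the
Yang–Baxter relation which is needed for the functoriality of `powMap`. -/
theorem insertLast_comm {n : ℕ} {a c : Fin (n + 1)} {b d : Fin (n + 2)}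
    (h₁ : b.succAbove a = d) (h₂ : d.succAbove c = b) :
    swapLast _ X ≫ insertLast X n a ▷ X ≫ insertLast X (n + 1) b =
      insertLast X n c ▷ X ≫ insertLast X (n + 1) d := by
  induction b using Fin.lastCases with
  | last =>
    rw [Fin.succAbove_last] at h₁
    subst h₁
    obtain rfl : c = Fin.last _ := by
      refine Fin.succAbove_right_injective (h₂.trans ?_)
      rw [Fin.succAbove_castSucc_of_le _ _ (Fin.le_last a), Fin.succ_last]
    rw [insertLast_last, insertLast_last, insertLast_castSucc]
    simp
  | cast b =>
    induction a using Fin.lastCases with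
    | last =>
      rw [Fin.succAbove_castSucc_of_le _ _ (Fin.le_last b), Fin.succ_last] at h₁
      subst h₁
      rw [Fin.succAbove_last] at h₂
      obtain rfl := Fin.castSucc_injective _ h₂
      rw [insertLast_last, insertLast_castSucc, insertLast_last, inv_hom_whiskerRight_assoc,
        reassoc_of% swapLast_swapLast]
    | cast a =>
      cases n with
      | zero => exact a.elim0
      | succ n =>
      rw [Fin.castSucc_succAbove_castSucc] at h₁
      subst h₁
      induction c using Fin.lastCases with
      | last =>
        rw [Fin.succAbove_castSucc_of_le _ _ (Fin.le_last _), Fin.succ_last] at h₂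
        exact absurd h₂.symm (Fin.castSucc_lt_last b).ne
      | cast c =>
      rw [Fin.castSucc_succAbove_castSucc] at h₂
      have h := congrArg (fun t => t ▷ X) (insertLast_comm rfl (Fin.castSucc_injective _ h₂))
      simp only [comp_whiskerRight] at h
      simp only [insertLast_castSucc, comp_whiskerRight, Category.assoc,
        inv_hom_whiskerRight_assoc]
      rw [← reassoc_of% swapLast_naturality, reassoc_of% (swapLast_naturality (insertLast X n a) X),
        reassoc_of% swapLast_braid, reassoc_of% (swapLast_naturality (insertLast X n c) X),
        reassoc_of% h]

/-- The map of tensor powers induced by a bijection `f`: the bijection of the complements of the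
last point and of its image permutes the first factors, and the last factor is inserted at its
place. -/
def powMap : (m n : ℕ) → (Fin m ≃ Fin n) → (tensorPow X m ⟶ tensorPow X n)
  | 0, 0, _ => 𝟙 _
  | m + 1, n + 1, f => (powSucc X m).hom ≫
      powMap m n (Niso.del f (Fin.last m)) ▷ X ≫ insertLast X n (f (Fin.last m))
  | 0, _ + 1, f => (f.symm 0).elim0
  | _ + 1, 0, f => (f 0).elim0

theorem powMap_succ {m n : ℕ} (f : Fin (m + 1) ≃ Fin (n + 1)) :
    powMap X (m + 1) (n + 1) f = (powSucc X m).hom ≫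
      powMap X m n (Niso.del f (Fin.last m)) ▷ X ≫ insertLast X n (f (Fin.last m)) := rfl

/-- The recursion which defines `powMap` holds with any point in place of the last one; this is
what makes `powMap` compatible with composition. -/
theorem insertLast_powMap {m n : ℕ} (f : Fin (m + 1) ≃ Fin (n + 1)) (p : Fin (m + 1)) :
    insertLast X m p ≫ powMap X (m + 1) (n + 1) f =
      powMap X m n (Niso.del f p) ▷ X ≫ insertLast X n (f p) := by
  induction m generalizing n with
  | zero =>
    obtain rfl : p = Fin.last 0 := Fin.ext (by omega)
    rw [insertLast_last, powMap_succ, Iso.inv_hom_id_assoc]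
  | succ m ih =>
    induction p using Fin.lastCases with
    | last => rw [insertLast_last, powMap_succ, Iso.inv_hom_id_assoc]
    | cast q =>
      cases n with
      | zero =>
        have := f.injective.eq_iff.1 (Subsingleton.elim (α := Fin 1) (f 0) (f 1))
        exact absurd this (by simp)
      | succ n =>
        have h := congrArg (fun t => t ▷ X) (ih (Niso.del f (Fin.last (m + 1))) q)
        simp only [comp_whiskerRight] at h
        rw [insertLast_castSucc, powMap_succ]
        simp only [Category.assoc, Iso.inv_hom_id_assoc]
        rw [reassoc_of% h, ← reassoc_of% swapLast_naturality, powMap_succ X (Niso.del f q.castSucc),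
          Niso.del_del, insertLast_comm X (c := Niso.del f q.castSucc (Fin.last m))
            (d := f q.castSucc)]
        · simp only [comp_whiskerRight, Category.assoc]
        · rw [Niso.succAbove_del, Fin.succAbove_last]
        · rw [Niso.succAbove_del, Fin.succAbove_castSucc_of_le _ _ (Fin.le_last q), Fin.succ_last]

theorem powMap_refl (n : ℕ) : powMap X n n (Equiv.refl _) = 𝟙 _ := by
  induction n with
  | zero => rfl
  | succ n ih =>
    rw [powMap_succ, Niso.del_refl, ih, Equiv.refl_apply, insertLast_last, id_whiskerRight,
      Category.id_comp, Iso.hom_inv_id]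

theorem powMap_trans {m n k : ℕ} (f : Fin m ≃ Fin n) (g : Fin n ≃ Fin k) :
    powMap X m k (f.trans g) = powMap X m n f ≫ powMap X n k g := by
  obtain rfl : m = n := by simpa using Fintype.card_congr f
  obtain rfl : m = k := by simpa using Fintype.card_congr g
  induction m with
  | zero => exact (Category.id_comp _).symm
  | succ m ih =>
    rw [powMap_succ, powMap_succ X f, Niso.del_trans, ih, Category.assoc, Category.assoc,
      insertLast_powMap, comp_whiskerRight, Category.assoc, Equiv.trans_apply]

/-- The tensor powers of `X`, as a functor on `Niso`. -/
def powFunctor : Niso ⥤ A where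
  obj n := tensorPow X n.n
  map f := powMap X _ _ f.equiv
  map_id _ := powMap_refl X _
  map_comp f g := powMap_trans X f.equiv g.equiv

/-- A bijection which maps the last point to the last point does not move the last factor. -/
theorem powMap_of_last {m n : ℕ} {f : Fin (m + 1) ≃ Fin (n + 1)} {g : Fin m ≃ Fin n}
    (h₁ : f (Fin.last m) = Fin.last n) (h₂ : ∀ i, f i.castSucc = (g i).castSucc) :
    powMap X (m + 1) (n + 1) f = (powSucc X m).hom ≫ powMap X m n g ▷ X ≫ (powSucc X n).inv := by
  rw [powMap_succ, h₁, insertLast_last, Niso.del_eq (g := g)]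
  intro i
  rw [h₁, Fin.succAbove_last, Fin.succAbove_last, h₂]

/-- The recursive definition of `exchange`, with the identities between tensor powers made
explicit. -/
theorem exchange_last (n : ℕ) : exchange X (n + 1) (Fin.last n) =
    (powSucc X (n + 1)).hom ≫ (powSucc X n).hom ▷ X ≫ swapLast _ X ≫ (powSucc X n).inv ▷ X ≫
      (powSucc X (n + 1)).inv := by
  have (t : (tensorPow X n ⊗ X) ⊗ X ⟶ (tensorPow X n ⊗ X) ⊗ X) :
      t = 𝟙 _ ≫ 𝟙 _ ▷ X ≫ t ≫ 𝟙 _ ▷ X ≫ 𝟙 _ := by simp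
  rw [exchange]
  exact (Fin.lastCases_last).trans (this _)

theorem exchange_castSucc (n : ℕ) (i : Fin n) : exchange X (n + 1) i.castSucc =
    (powSucc X (n + 1)).hom ≫ exchange X n i ▷ X ≫ (powSucc X (n + 1)).inv := by
  have (t : tensorPow X (n + 1) ⊗ X ⟶ tensorPow X (n + 1) ⊗ X) : t = 𝟙 _ ≫ t ≫ 𝟙 _ := by simp
  rw [exchange]
  exact (Fin.lastCases_castSucc _).trans (this _)

/-- The transpositions of neighbours act by the commutativity constraint. -/
theorem powMap_swap (n : ℕ) (i : Fin n) :
    powMap X (n + 1) (n + 1) (Equiv.swap i.castSucc i.succ) = exchange X n i := by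
  induction n with
  | zero => exact i.elim0
  | succ n ih =>
    induction i using Fin.lastCases with
    | last =>
      rw [exchange_last, powMap_succ, Fin.succ_last, Equiv.swap_apply_right,
        insertLast_castSucc, insertLast_last, Niso.del_eq (g := Equiv.refl _), powMap_refl,
        id_whiskerRight, Category.id_comp]
      · intro i
        rw [Equiv.swap_apply_right, Equiv.refl_apply, Fin.succAbove_last, Equiv.swap_apply_def]
        simp only [Fin.succAbove, Fin.lt_def, Fin.ext_iff]
        split_ifs <;> simp at * <;> omega
    | cast i =>
      rw [exchange_castSucc, ← ih]
      refine powMap_of_last X ?_ ?_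
      · refine Equiv.swap_apply_of_ne_of_ne ?_ ?_ <;>
          simp [Fin.ext_iff] <;> omega
      · intro j
        rw [Equiv.swap_apply_def, Equiv.swap_apply_def]
        simp only [Fin.ext_iff]
        split_ifs <;> simp at * <;> omega

/-- The action of the symmetric groups on the tensor powers of `X`. -/
def powAction : PermutationAction X where
  act n :=
    { toFun σ := powMap X n n σ
      map_one' := powMap_refl X n
      map_mul' σ τ := powMap_trans X τ σ }
  act_swap n i := powMap_swap X n i

/-- The symmetric groups act in only one way, because the transpositions of neighbours generate
them. -/
theorem eq_powAction (ρ : PermutationAction X) : ρ = powAction X := by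
  obtain ⟨act, h⟩ := ρ
  have : act = (powAction X).act := by
    funext n
    cases n with
    | zero => exact MonoidHom.ext fun σ => by rw [Subsingleton.elim σ 1, map_one, map_one]
    | succ n =>
      refine MonoidHom.eq_of_eqOn_denseM (Equiv.Perm.mclosure_swap_castSucc_succ n) ?_
      rintro _ ⟨i, rfl⟩
      exact (h n i).trans ((powAction X).act_swap n i).symm
  subst this
  rfl

end Powers

section Powers

variable {A : Type v} [Category.{u} A] [MonoidalCategory A] [SymmetricCategory A]
variable (X : A)

/-! ### The tensor powers form a symmetric monoidal functor -/

/-- The defining isomorphism `X^{⊗0} ≅ 𝟙`. -/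
def powZero : tensorPow X 0 ≅ 𝟙_ A := Iso.refl (𝟙_ A)

/-- The isomorphism `X^{⊗(m+0)} ≅ X^{⊗m}`, an identity. -/
def powAddZero (m : ℕ) : tensorPow X (m + 0) ≅ tensorPow X m := Iso.refl (tensorPow X m)

/-- The isomorphism `X^{⊗(m+(k+1))} ≅ X^{⊗(m+k)} ⊗ X`, an identity. -/
def powAddSucc (m k : ℕ) : tensorPow X (m + (k + 1)) ≅ tensorPow X (m + k) ⊗ X :=
  powSucc X (m + k)

/-- The isomorphism `X^{⊗m} ⊗ X^{⊗k} ≅ X^{⊗(m+k)}`, which shifts the brackets. -/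
def powAdd (m : ℕ) : (k : ℕ) → (tensorPow X m ⊗ tensorPow X k ≅ tensorPow X (m + k))
  | 0 => whiskerLeftIso _ (powZero X) ≪≫ ρ_ (tensorPow X m) ≪≫ (powAddZero X m).symm
  | k + 1 => whiskerLeftIso _ (powSucc X k) ≪≫ (α_ _ _ _).symm ≪≫
      whiskerRightIso (powAdd m k) X ≪≫ (powAddSucc X m k).symm

theorem powAdd_zero (m : ℕ) : (powAdd X m 0).hom =
    tensorPow X m ◁ (powZero X).hom ≫ (ρ_ (tensorPow X m)).hom ≫ (powAddZero X m).inv := rfl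

theorem powAdd_succ (m k : ℕ) :
    (powAdd X m (k + 1)).hom = tensorPow X m ◁ (powSucc X k).hom ≫ (α_ _ _ _).inv ≫
      (powAdd X m k).hom ▷ X ≫ (powAddSucc X m k).inv := rfl

theorem powMap_add_zero {m m' : ℕ} {f : Fin (m + 0) ≃ Fin (m' + 0)} {g : Fin m ≃ Fin m'}
    (h : ∀ i, f i = g i) :
    powMap X _ _ f = (powAddZero X m).hom ≫ powMap X m m' g ≫ (powAddZero X m').inv := by
  obtain rfl : f = g := Equiv.ext h
  have (t : tensorPow X m ⟶ tensorPow X m') : t = 𝟙 _ ≫ t ≫ 𝟙 _ := by simp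
  exact this _

/-- A bijection of disjoint unions which preserves the last point, up to the bracketing `m + (k +
1)` of the source and of the target. -/
theorem powMap_add_succ {m k m' k' : ℕ} {f : Fin (m + (k + 1)) ≃ Fin (m' + (k' + 1))}
    {g : Fin (m + k) ≃ Fin (m' + k')}
    (h₁ : f (Fin.natAdd m (Fin.last k)) = Fin.natAdd m' (Fin.last k'))
    (h₂ : ∀ i : Fin (m + k), (f (Fin.castSucc i : Fin (m + k + 1)) : ℕ) = g i) :
    powMap X _ _ f = (powAddSucc X m k).hom ≫ powMap X _ _ g ▷ X ≫ (powAddSucc X m' k').inv :=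
  powMap_of_last X (m := m + k) (n := m' + k') h₁ fun i => Fin.ext (h₂ i)

theorem val_sumMap {a b c d : ℕ} (f : Fin a ≃ Fin c) (g : Fin b ≃ Fin d) (i : Fin (a + b)) :
    (Niso.sumMap f g i : ℕ) =
      if h : (i : ℕ) < a then (f ⟨i, h⟩ : ℕ) else c + (g ⟨i - a, by omega⟩ : ℕ) := by
  induction i using Fin.addCases with
  | left i => rw [Niso.sumMap_left]; simp
  | right i => rw [Niso.sumMap_right]; simp

theorem val_sumAssoc {a b c : ℕ} (i : Fin (a + b + c)) : (Niso.sumAssoc a b c i : ℕ) = i := by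
  induction i using Fin.addCases with
  | left i =>
    induction i using Fin.addCases with
    | left i => rw [Niso.sumAssoc_1]; simp
    | right i => rw [Niso.sumAssoc_2]; simp
  | right i => rw [Niso.sumAssoc_3]; simp [Nat.add_assoc]

theorem val_zeroSum {a : ℕ} (i : Fin (0 + a)) : (Niso.zeroSum a i : ℕ) = i := by
  induction i using Fin.addCases with
  | left i => exact i.elim0
  | right i => rw [Niso.zeroSum_right]; simp

theorem powAdd_natural_left {m m' : ℕ} (f : Fin m ≃ Fin m') (k : ℕ) :
    powMap X m m' f ▷ tensorPow X k ≫ (powAdd X m' k).hom =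
      (powAdd X m k).hom ≫ powMap X _ _ (Niso.sumMap f (Equiv.refl (Fin k))) := by
  induction k with
  | zero =>
    rw [powMap_add_zero X (g := f) (fun i => Niso.sumMap_left _ _ _), powAdd_zero, powAdd_zero,
      ← whisker_exchange_assoc]
    simp
  | succ k ih =>
    have h' := congrArg (fun t => t ▷ X) ih
    simp only [comp_whiskerRight] at h'
    rw [powMap_add_succ X (g := Niso.sumMap f (Equiv.refl (Fin k))) (Niso.sumMap_right _ _ _)
      (fun i => by simp [val_sumMap]), powAdd_succ, powAdd_succ, ← whisker_exchange_assoc,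
      associator_inv_naturality_left_assoc, reassoc_of% h']
    simp only [Category.assoc, Iso.inv_hom_id_assoc]

/-- The insertion of the last factor of `X^{⊗(m+k)} ⊗ X` at position `m + p`. -/
def insertAdd (m k : ℕ) (p : Fin (k + 1)) : tensorPow X (m + k) ⊗ X ⟶ tensorPow X (m + (k + 1)) :=
  insertLast X (m + k) (p.natAdd m)

theorem insertAdd_last (m k : ℕ) : insertAdd X m k (Fin.last k) = (powAddSucc X m k).inv :=
  insertLast_last X (m + k)

theorem insertAdd_castSucc (m k : ℕ) (q : Fin (k + 1)) :
    insertAdd X m (k + 1) q.castSucc = (powAddSucc X m k).hom ▷ X ≫ swapLast _ X ≫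
      insertAdd X m k q ▷ X ≫ (powAddSucc X m (k + 1)).inv :=
  insertLast_castSucc X (m + k) (q.natAdd m)

/-- The recursion for `powMap`, for a bijection which maps the last point into the second summand.
-/
theorem powMap_add {m k : ℕ} {f : Fin (m + (k + 1)) ≃ Fin (m + (k + 1))}
    {g : Fin (m + k) ≃ Fin (m + k)} {p : Fin (k + 1)}
    (h₁ : f (Fin.natAdd m (Fin.last k)) = Fin.natAdd m p)
    (h₂ : ∀ i : Fin (m + k), (Fin.natAdd m p : Fin (m + k + 1)).succAbove (g i) =
      f (Fin.castSucc i : Fin (m + k + 1))) :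
    powMap X _ _ f = (powAddSucc X m k).hom ≫ powMap X _ _ g ▷ X ≫ insertAdd X m k p := by
  have h := powMap_succ X (m := m + k) (n := m + k) f
  have hl : f (Fin.last (m + k)) = Fin.natAdd m p := h₁
  rw [hl, Niso.del_eq (g := g) (fun i => by rw [hl, Fin.succAbove_last, h₂])] at h
  exact h

theorem whiskerLeft_swapLast (T S X : A) :
    T ◁ swapLast S X ≫ (α_ _ _ _).inv ≫ (α_ _ _ _).inv ▷ X =
      (α_ _ _ _).inv ≫ (α_ _ _ _).inv ▷ X ≫ swapLast (T ⊗ S) X := by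
  simp only [swapLast]
  monoidal

/-- Insertion into the second factor of `X^{⊗m} ⊗ X^{⊗k}`. -/
theorem insertLast_powAdd (m k : ℕ) (p : Fin (k + 1)) :
    tensorPow X m ◁ insertLast X k p ≫ (powAdd X m (k + 1)).hom =
      (α_ _ _ _).inv ≫ (powAdd X m k).hom ▷ X ≫ insertAdd X m k p := by
  induction k with
  | zero =>
    obtain rfl : p = Fin.last 0 := Fin.ext (by omega)
    rw [insertAdd_last, powAdd_succ, insertLast_last, whiskerLeft_inv_hom_assoc]
  | succ k ih =>
    induction p using Fin.lastCases with
    | last =>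
      rw [insertAdd_last, insertLast_last, powAdd_succ X m (k + 1), whiskerLeft_inv_hom_assoc]
    | cast q =>
      have ih' := congrArg (fun t => t ▷ X) (ih q)
      simp only [comp_whiskerRight] at ih'
      have hs := whiskerLeft_swapLast (tensorPow X m) (tensorPow X k) X
      rw [insertAdd_castSucc, insertLast_castSucc, powAdd_succ X m (k + 1)]
      simp only [whiskerLeft_comp, Category.assoc, whiskerLeft_inv_hom_assoc]
      rw [associator_inv_naturality_middle_assoc, reassoc_of% ih', reassoc_of% hs,
        associator_inv_naturality_middle_assoc, powAdd_succ X m k]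
      simp only [comp_whiskerRight, Category.assoc, inv_hom_whiskerRight_assoc]
      rw [reassoc_of% swapLast_naturality]

theorem powAdd_natural_right (m : ℕ) {k k' : ℕ} (g : Fin k ≃ Fin k') :
    tensorPow X m ◁ powMap X k k' g ≫ (powAdd X m k').hom =
      (powAdd X m k).hom ≫ powMap X _ _ (Niso.sumMap (Equiv.refl (Fin m)) g) := by
  obtain rfl : k = k' := by simpa using Fintype.card_congr g
  induction k with
  | zero =>
    have h : powMap X _ _ (Niso.sumMap (Equiv.refl (Fin m)) g) = 𝟙 _ := by
      rw [powMap_add_zero X (m := m) (m' := m) (g := Equiv.refl (Fin m))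
        (fun i => Niso.sumMap_left (Equiv.refl (Fin m)) g i), powMap_refl, Category.id_comp,
        Iso.hom_inv_id]
    have h' : powMap X 0 0 g = 𝟙 _ := rfl
    rw [h, h', whiskerLeft_id, Category.id_comp, Category.comp_id]
  | succ k ih =>
    have h' := congrArg (fun t => t ▷ X) (ih (Niso.del g (Fin.last k)))
    simp only [comp_whiskerRight] at h'
    rw [powMap_succ, whiskerLeft_comp, whiskerLeft_comp, Category.assoc,
      Category.assoc, insertLast_powAdd, associator_inv_naturality_middle_assoc,
      reassoc_of% h', powMap_add X (g := Niso.sumMap (Equiv.refl (Fin m)) (Niso.del g (Fin.last k)))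
        (p := g (Fin.last k)) (Niso.sumMap_right _ _ _), powAdd_succ X m k]
    · simp only [Category.assoc, Iso.inv_hom_id_assoc]
    · intro i
      induction i using Fin.addCases with
      | left i =>
        rw [Niso.sumMap_left]
        refine Eq.trans ?_ (Niso.sumMap_left (Equiv.refl (Fin m)) g i).symm
        refine Fin.succAbove_of_castSucc_lt _ _ ?_
        simp [Fin.lt_def]
        omega
      | right i =>
        rw [Niso.sumMap_right]
        refine Eq.trans ?_ (Niso.sumMap_right (Equiv.refl (Fin m)) g i.castSucc).symm
        have h := Niso.succAbove_del g (Fin.last k) i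
        rw [Fin.succAbove_last] at h
        rw [← h]
        simp only [Fin.succAbove, Fin.lt_def, Fin.ext_iff]
        split_ifs <;> simp at * <;> omega

theorem powAdd_assoc (m k l : ℕ) :
    (powAdd X m k).hom ▷ tensorPow X l ≫ (powAdd X (m + k) l).hom ≫
      powMap X _ _ (Niso.sumAssoc m k l) =
    (α_ _ _ _).hom ≫ tensorPow X m ◁ (powAdd X k l).hom ≫ (powAdd X m (k + l)).hom := by
  induction l with
  | zero =>
    have h : powMap X _ _ (Niso.sumAssoc m k 0) = (powAddZero X (m + k)).hom :=
      (powMap_add_zero X (m := m + k) (m' := m + k) (f := Niso.sumAssoc m k 0) (g := Equiv.refl _)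
        (fun i => Fin.ext (val_sumAssoc i))).trans (by
          rw [powMap_refl, Category.id_comp]; exact Category.comp_id _)
    have h₂ : (powAdd X m (k + 0)).hom =
        tensorPow X m ◁ (powAddZero X k).hom ≫ (powAdd X m k).hom := by
      have (t : tensorPow X m ⊗ tensorPow X k ⟶ tensorPow X (m + k)) :
        t = tensorPow X m ◁ 𝟙 _ ≫ t := by simp
      exact this _
    rw [h₂]
    refine (congrArg (fun t => _ ≫ t) (congrArg (fun t => _ ≫ t) h)).trans ?_
    rw [powAdd_zero, powAdd_zero]
    simp only [Category.assoc]
    rw [← whisker_exchange_assoc]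
    simp
  | succ l ih =>
    have ih' := congrArg (fun t => t ▷ X) ih
    simp only [comp_whiskerRight] at ih'
    have h : powMap X _ _ (Niso.sumAssoc m k (l + 1)) = (powAddSucc X (m + k) l).hom ≫
        powMap X _ _ (Niso.sumAssoc m k l) ▷ X ≫ (powAddSucc X m (k + l)).inv :=
      powMap_add_succ X (m := m + k) (k := l) (m' := m) (k' := k + l)
        (f := Niso.sumAssoc m k (l + 1)) (g := Niso.sumAssoc m k l)
        (Niso.sumAssoc_3 (Fin.last l)) fun i =>
          (val_sumAssoc (c := l + 1) i.castSucc).trans (val_sumAssoc i).symm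
    have h₂ : (powAdd X m (k + (l + 1))).hom =
        tensorPow X m ◁ (powAddSucc X k l).hom ≫ (α_ _ _ _).inv ≫
        (powAdd X m (k + l)).hom ▷ X ≫ (powAddSucc X m (k + l)).inv := rfl
    rw [h₂]
    refine (congrArg (fun t => _ ≫ t) (congrArg (fun t => _ ≫ t) h)).trans ?_
    rw [powAdd_succ, powAdd_succ]
    simp only [whiskerLeft_comp, Category.assoc, Iso.inv_hom_id_assoc, whiskerLeft_inv_hom_assoc]
    rw [← whisker_exchange_assoc, associator_inv_naturality_left_assoc, reassoc_of% ih',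
      associator_inv_naturality_middle_assoc]
    simp

theorem powAdd_left_unit (m : ℕ) :
    (λ_ (tensorPow X m)).hom = (powZero X).inv ▷ tensorPow X m ≫ (powAdd X 0 m).hom ≫
      powMap X _ _ (Niso.zeroSum m) := by
  induction m with
  | zero =>
    have h : powMap X _ _ (Niso.zeroSum 0) = (powAddZero X 0).hom := by
      have : Niso.zeroSum 0 = Equiv.refl _ := Equiv.ext fun i => i.elim0
      rw [this]
      rfl
    rw [h, powAdd_zero]
    simp only [Category.assoc]
    rw [← whisker_exchange_assoc]
    simp [← unitors_equal]
  | succ m ih =>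
    have ih' := congrArg (fun t => t ▷ X) ih
    simp only [comp_whiskerRight] at ih'
    have h : powMap X _ _ (Niso.zeroSum (m + 1)) = (powAddSucc X 0 m).hom ≫
        powMap X _ _ (Niso.zeroSum m) ▷ X ≫ (powSucc X m).inv :=
      powMap_of_last X (m := 0 + m) (n := m)
        (f := Niso.zeroSum (m + 1)) (g := Niso.zeroSum m)
        (Niso.zeroSum_right (Fin.last m)) (fun i => Fin.ext
          ((val_zeroSum (a := m + 1) i.castSucc).trans (val_zeroSum i).symm))
    rw [h, powAdd_succ]
    simp only [Category.assoc, Iso.inv_hom_id_assoc]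
    rw [← whisker_exchange_assoc, associator_inv_naturality_left_assoc, ← reassoc_of% ih']
    simp

theorem powAdd_right_unit (m : ℕ) :
    (ρ_ (tensorPow X m)).hom = tensorPow X m ◁ (powZero X).inv ≫ (powAdd X m 0).hom ≫
      powMap X _ _ (Niso.sumZero m) := by
  have h : powMap X _ _ (Niso.sumZero m) = (powAddZero X m).hom :=
    (powMap_add_zero X (m := m) (m' := m) (f := Niso.sumZero m) (g := Equiv.refl _)
      Niso.sumZero_left).trans (by
          rw [powMap_refl, Category.id_comp]; exact Category.comp_id _)
  rw [h, powAdd_zero]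
  simp

/-- The monoidal structure of `powFunctor X`. -/
def powCoreMonoidal : (powFunctor X).CoreMonoidal where
  εIso := (powZero X).symm
  μIso m k := powAdd X m.n k.n
  μIso_hom_natural_left f k := powAdd_natural_left X f.equiv k.n
  μIso_hom_natural_right m g := powAdd_natural_right X m.n g.equiv
  associativity m k l := powAdd_assoc X m.n k.n l.n
  left_unitality m := powAdd_left_unit X m.n
  right_unitality m := powAdd_right_unit X m.n

instance : (powFunctor X).Monoidal := (powCoreMonoidal X).toMonoidal

/-- For `X ⊗ X` the compatibility with the braiding holds by the definition of the action of the
transposition. -/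
theorem powFunctor_braided_one : powMap X _ _ (Niso.sumComm 1 1) =
    (powAdd X 1 1).inv ≫ (β_ (tensorPow X 1) (tensorPow X 1)).hom ≫ (powAdd X 1 1).hom := by
  let s : tensorPow X 1 ≅ X := powSucc X 0 ≪≫ whiskerRightIso (powZero X) X ≪≫ λ_ X
  let r : X ⊗ X ≅ tensorPow X (1 + 1) :=
    whiskerRightIso s.symm X ≪≫ (powSucc X 1).symm
  have h₁ : (powAdd X 1 1).hom = (s.hom ⊗ₘ s.hom) ≫ r.hom := by
    have h : (powAddZero X 1).inv ▷ X ≫ (powAddSucc X 1 0).inv = (powSucc X 1).inv :=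
      (congrArg (fun t => t ≫ 𝟙 (tensorPow X 1 ⊗ X)) (id_whiskerRight _ _)).trans
        (Category.id_comp _)
    rw [MonoidalCategory.tensorHom_def', powAdd_succ, powAdd_zero]
    simp only [r, s, comp_whiskerRight, Category.assoc, Iso.trans_hom, whiskerRightIso_hom,
      Iso.symm_hom, Iso.trans_symm, whiskerLeft_comp, h]
    simp
  have h₂ : powMap X _ _ (Niso.sumComm 1 1) = r.inv ≫ (β_ X X).hom ≫ r.hom := by
    have h : Niso.sumComm 1 1 = Equiv.swap (Fin.last 0).castSucc (Fin.last 0).succ :=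
      Niso.equiv_ext (fun i => by
          rw [Subsingleton.elim i 0, Niso.sumComm_left]
          exact (Equiv.swap_apply_left _ _).symm)
        (fun i => by
          rw [Subsingleton.elim i 0, Niso.sumComm_right]
          exact (Equiv.swap_apply_right _ _).symm)
    let q : X ⟶ tensorPow X 0 ⊗ X := (λ_ X).inv ≫ (powZero X).inv ▷ X
    have hq : r.hom = q ▷ X ≫ (powSucc X 0).inv ▷ X ≫ (powSucc X 1).inv := by simp [q, r, s]
    have hs : (λ_ X).inv ▷ X ≫ swapLast (𝟙_ A) X = (β_ X X).hom ≫ (λ_ X).inv ▷ X := by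
      simp [swapLast]
    rw [h, powMap_swap, exchange_last, ← cancel_epi r.hom, Iso.hom_inv_id_assoc, hq]
    simp only [Category.assoc, Iso.inv_hom_id_assoc, inv_hom_whiskerRight_assoc, q,
      comp_whiskerRight]
    rw [reassoc_of% swapLast_naturality, reassoc_of% hs]
  rw [h₂, ← cancel_epi (powAdd X 1 1).hom, Iso.hom_inv_id_assoc, h₁, Category.assoc,
    Iso.hom_inv_id_assoc, BraidedCategory.braiding_naturality_assoc]

end Powers

/-! ### Compatibility with the braiding -/

section Braided

variable {C : Type*} [Category* C] [MonoidalCategory C] [SymmetricCategory C]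
  {D : Type*} [Category* D] [MonoidalCategory D] [SymmetricCategory D]
  (F : C ⥤ D) [F.Monoidal]

open Functor.LaxMonoidal

/-- The monoidal functor `F` is compatible with the braiding of `X` and `Y`. The pairs with this
property are closed under tensor products, by the hexagon identities. -/
def IsBraidedAt (X Y : C) : Prop :=
  μ F X Y ≫ F.map (β_ X Y).hom = (β_ (F.obj X) (F.obj Y)).hom ≫ μ F Y X

variable {F}

theorem IsBraidedAt.symm {X Y : C} (h : IsBraidedAt F X Y) : IsBraidedAt F Y X := by
  rw [IsBraidedAt, ← cancel_epi (β_ (F.obj X) (F.obj Y)).hom, ← reassoc_of% h, ← F.map_comp,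
    SymmetricCategory.symmetry, F.map_id, SymmetricCategory.symmetry_assoc, Category.comp_id]

theorem isBraidedAt_unit (X : C) : IsBraidedAt F X (𝟙_ C) := by
  rw [IsBraidedAt, ← cancel_epi (F.obj X ◁ ε F), BraidedCategory.braiding_naturality_right_assoc,
    braiding_tensorUnit_right, braiding_tensorUnit_right, F.map_comp]
  simp

theorem IsBraidedAt.tensor {X Y Z : C} (h₁ : IsBraidedAt F X Y) (h₂ : IsBraidedAt F X Z) :
    IsBraidedAt F X (Y ⊗ Z) := by
  have h := congrArg (fun t => (α_ X Y Z).inv ≫ t ≫ (α_ Y Z X).inv)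
    (BraidedCategory.hexagon_forward X Y Z)
  simp only [Category.assoc, Iso.hom_inv_id, Category.comp_id, Iso.inv_hom_id_assoc] at h
  have h' := congrArg (fun t => (α_ (F.obj X) (F.obj Y) (F.obj Z)).inv ≫ t ≫ (α_ _ _ _).inv)
    (BraidedCategory.hexagon_forward (F.obj X) (F.obj Y) (F.obj Z))
  simp only [Category.assoc, Iso.hom_inv_id, Category.comp_id, Iso.inv_hom_id_assoc] at h'
  have h₁' := congrArg (fun t => t ▷ F.obj Z) h₁
  have h₂' := congrArg (fun t => F.obj Y ◁ t) h₂
  simp only [comp_whiskerRight, whiskerLeft_comp] at h₁' h₂'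
  rw [IsBraidedAt, ← cancel_epi (F.obj X ◁ μ F Y Z), h,
    BraidedCategory.braiding_naturality_right_assoc, h']
  simp only [F.map_comp, Category.assoc, associativity_inv_assoc]
  rw [← μ_natural_left_assoc, reassoc_of% h₁', associativity_assoc, ← μ_natural_right_assoc,
    reassoc_of% h₂', associativity_inv]
end Braided

instance {A : Type v} [Category.{u} A] [MonoidalCategory A] [SymmetricCategory A] (X : A) :
    (powFunctor X).Braided where
  braided := by
    -- every object of `Niso` is a tensor power of the object `1`
    have h₁ : IsBraidedAt (powFunctor X) ⟨1⟩ ⟨1⟩ := by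
      have := congrArg (fun t => (powAdd X 1 1).hom ≫ t) (powFunctor_braided_one X)
      simp only [Iso.hom_inv_id_assoc] at this
      exact this
    have h₂ (m : ℕ) : IsBraidedAt (powFunctor X) ⟨1⟩ ⟨m⟩ := by
      induction m with
      | zero => exact isBraidedAt_unit _
      | succ m ih => exact ih.tensor (Z := (⟨1⟩ : Niso)) h₁
    have h₃ (m k : ℕ) : IsBraidedAt (powFunctor X) ⟨m⟩ ⟨k⟩ := by
      induction k with
      | zero => exact isBraidedAt_unit _
      | succ k ih => exact ih.tensor (Z := (⟨1⟩ : Niso)) (h₂ m).symm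
    exact fun m k => h₃ m.n k.n


/-! ### Symmetric monoidal functors on `Niso` are determined by the image of `1` -/

section
open Functor.LaxMonoidal Functor.Monoidal
open Functor.OplaxMonoidal (δ η δ_natural_left_assoc)

/-- A symmetric monoidal functor preserves the exchange of the last two factors. -/
theorem map_swapLast {C : Type*} [Category* C] [MonoidalCategory C] [SymmetricCategory C]
    {D : Type*} [Category* D] [MonoidalCategory D] [SymmetricCategory D] (F : C ⥤ D) [F.Braided]
    (T X : C) : μ F T X ▷ F.obj X ≫ μ F (T ⊗ X) X ≫ F.map (swapLast T X) =
      swapLast (F.obj T) (F.obj X) ≫ μ F T X ▷ F.obj X ≫ μ F (T ⊗ X) X := by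
  have h := congrArg (fun t => F.obj T ◁ t) (Functor.LaxBraided.braided (F := F) X X)
  simp only [whiskerLeft_comp] at h
  simp only [swapLast, F.map_comp, Category.assoc]
  rw [associativity_assoc, ← μ_natural_right_assoc, reassoc_of% h, associativity_inv]

variable {A : Type v} [Category.{u} A] [MonoidalCategory A] [SymmetricCategory A]
  {G H : Niso ⥤ A} [G.Braided] [H.Braided] (f : G.obj ⟨1⟩ ⟶ H.obj ⟨1⟩)

/-- The components of the monoidal transformation which extends a map `f : G 1 ⟶ H 1`. The
recursion is the one which compatibility with the tensor products `n + 1 = n ⊗ 1` forces. -/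
def extendNat : (n : ℕ) → (G.obj ⟨n⟩ ⟶ H.obj ⟨n⟩)
  | 0 => η G ≫ ε H
  | n + 1 => δ G ⟨n⟩ ⟨1⟩ ≫ (extendNat n ⊗ₘ f) ≫ μ H ⟨n⟩ ⟨1⟩

/-- The map `extendNat`, for the objects of `Niso`. -/
def extendApp (m : Niso) : G.obj m ⟶ H.obj m := extendNat f m.n

theorem extendApp_unit : extendApp f (𝟙_ Niso) = η G ≫ ε H := rfl

theorem extendApp_tensor_one (m : Niso) :
    extendApp f (m ⊗ ⟨1⟩) = δ G m ⟨1⟩ ≫ (extendApp f m ⊗ₘ f) ≫ μ H m ⟨1⟩ := rfl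

/-- The components `extendApp f` are natural with respect to the bijection `σ`. -/
def ExtendNatural {m n : Niso} (σ : m ⟶ n) : Prop :=
  G.map σ ≫ extendApp f n = extendApp f m ≫ H.map σ

variable {f}

theorem ExtendNatural.comp {m n k : Niso} {σ : m ⟶ n} {τ : n ⟶ k} (h : ExtendNatural f σ)
    (h' : ExtendNatural f τ) : ExtendNatural f (σ ≫ τ) := by
  unfold ExtendNatural at *
  rw [G.map_comp, H.map_comp, Category.assoc, h', reassoc_of% h]

theorem ExtendNatural.whiskerRight {m n : Niso} {σ : m ⟶ n} (h : ExtendNatural f σ) :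
    ExtendNatural f (σ ▷ ⟨1⟩) := by
  unfold ExtendNatural at *
  rw [extendApp_tensor_one, extendApp_tensor_one, Category.assoc, Category.assoc, ← μ_natural_left,
    ← δ_natural_left_assoc, ← tensorHom_id, ← tensorHom_id, tensorHom_comp_tensorHom_assoc,
    tensorHom_comp_tensorHom_assoc, h, Category.id_comp, Category.comp_id]

variable (f)

theorem extendNatural_swapLast (m : Niso) : ExtendNatural f (swapLast m ⟨1⟩) := by
  have h : swapLast (G.obj m) (G.obj ⟨1⟩) ≫ ((extendApp f m ⊗ₘ f) ⊗ₘ f) =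
      ((extendApp f m ⊗ₘ f) ⊗ₘ f) ≫ swapLast (H.obj m) (H.obj ⟨1⟩) := by
    simp only [swapLast, Category.assoc, associator_naturality_assoc]
    rw [← associator_inv_naturality, ← id_tensorHom, ← id_tensorHom,
      tensorHom_comp_tensorHom_assoc, tensorHom_comp_tensorHom_assoc,
      BraidedCategory.braiding_naturality, Category.id_comp, Category.comp_id]
  have e : μ G m ⟨1⟩ ▷ G.obj ⟨1⟩ ≫ μ G (m ⊗ ⟨1⟩) ⟨1⟩ ≫ extendApp f ((m ⊗ ⟨1⟩) ⊗ ⟨1⟩) =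
      ((extendApp f m ⊗ₘ f) ⊗ₘ f) ≫ μ H m ⟨1⟩ ▷ H.obj ⟨1⟩ ≫ μ H (m ⊗ ⟨1⟩) ⟨1⟩ := by
    rw [extendApp_tensor_one, extendApp_tensor_one, μ_δ_assoc, ← tensorHom_id, ← tensorHom_id,
      tensorHom_comp_tensorHom_assoc, tensorHom_comp_tensorHom_assoc, μ_δ_assoc, Category.id_comp,
      Category.comp_id]
  rw [ExtendNatural, ← cancel_epi (μ G (m ⊗ ⟨1⟩) ⟨1⟩), ← cancel_epi (μ G m ⟨1⟩ ▷ G.obj ⟨1⟩),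
    reassoc_of% map_swapLast, e, reassoc_of% h, reassoc_of% e, map_swapLast]

theorem extendNatural_swap (n : ℕ) (i : Fin n) :
    ExtendNatural f (⟨Equiv.swap i.castSucc i.succ⟩ : (⟨n + 1⟩ : Niso) ⟶ ⟨n + 1⟩) := by
  induction n with
  | zero => exact i.elim0
  | succ n ih =>
    induction i using Fin.lastCases with
    | last =>
      have h := extendNatural_swapLast f ⟨n⟩
      have e : (⟨Equiv.swap (Fin.last n).castSucc (Fin.last n).succ⟩ :
          (⟨n + 1 + 1⟩ : Niso) ⟶ ⟨n + 1 + 1⟩) = swapLast (⟨n⟩ : Niso) ⟨1⟩ := by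
        rw [swapLast, ← Category.assoc]
        refine (Iso.eq_comp_inv (α_ (⟨n⟩ : Niso) ⟨1⟩ ⟨1⟩)).2 (Niso.hom_ext fun i => Fin.ext ?_)
        refine (val_sumAssoc (a := n) (b := 1) (c := 1) _).trans ?_
        change _ = (Niso.sumMap (Equiv.refl (Fin n)) (Niso.sumComm 1 1)
          (Niso.sumAssoc n 1 1 i) : ℕ)
        rw [val_sumMap]
        have hc : ∀ j : Fin (1 + 1), (Niso.sumComm 1 1 j : ℕ) = 1 - j := fun j => by
          induction j using Fin.addCases with
          | left j => rw [Niso.sumComm_left]; simp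
          | right j => rw [Niso.sumComm_right]; simp
        change (Equiv.swap (Fin.last n).castSucc (Fin.last n).succ i : ℕ) = _
        simp only [Equiv.swap_apply_def, Fin.ext_iff, hc, val_sumAssoc, Equiv.refl_apply]
        have := i.isLt
        split_ifs <;> simp at * <;> omega
      rw [e]
      exact h
    | cast i =>
      have h := (ih i).whiskerRight
      have e : (⟨Equiv.swap i.castSucc.castSucc i.castSucc.succ⟩ :
          (⟨n + 1 + 1⟩ : Niso) ⟶ ⟨n + 1 + 1⟩) =
          (⟨Equiv.swap i.castSucc i.succ⟩ : (⟨n + 1⟩ : Niso) ⟶ ⟨n + 1⟩) ▷ (⟨1⟩ : Niso) := by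
        refine Niso.hom_ext fun j => Fin.ext ?_
        refine Eq.trans ?_ (val_sumMap (Equiv.swap i.castSucc i.succ) (Equiv.refl (Fin 1)) j).symm
        change (Equiv.swap i.castSucc.castSucc i.castSucc.succ j : ℕ) = _
        simp only [Equiv.swap_apply_def, Fin.ext_iff, Equiv.refl_apply]
        split_ifs <;> simp at * <;> omega
      rw [e]
      exact h

/-- The groups of permutations are generated by the transpositions of neighbours. -/
theorem extendNatural {m n : Niso} (σ : m ⟶ n) : ExtendNatural f σ := by
  obtain ⟨m⟩ := m
  obtain ⟨n⟩ := n
  obtain ⟨σ⟩ := σ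
  obtain rfl : m = n := by simpa using Fintype.card_congr σ
  have hid : ExtendNatural f (𝟙 (⟨m⟩ : Niso)) := by
    rw [ExtendNatural, G.map_id, H.map_id, Category.id_comp, Category.comp_id]
  cases m with
  | zero =>
    rw [Subsingleton.elim σ (Equiv.refl _)]
    exact hid
  | succ m =>
    have h : σ ∈ Submonoid.closure (Set.range fun i : Fin m => Equiv.swap i.castSucc i.succ) := by
      rw [Equiv.Perm.mclosure_swap_castSucc_succ]
      trivial
    induction h using Submonoid.closure_induction with
    | mem σ h =>
      obtain ⟨i, rfl⟩ := h
      exact extendNatural_swap f m i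
    | one => exact hid
    | mul σ τ _ _ h₁ h₂ => exact h₂.comp h₁

/-- The transformation which extends a map `f : G 1 ⟶ H 1`. -/
def extend : G ⟶ H where
  app := extendApp f
  naturality _ _ σ := extendNatural f σ

theorem μ_extendApp (m : Niso) (k : ℕ) : μ G m ⟨k⟩ ≫ extendApp f (m ⊗ ⟨k⟩) =
    (extendApp f m ⊗ₘ extendApp f ⟨k⟩) ≫ μ H m ⟨k⟩ := by
  induction k with
  | zero =>
    change μ G m (𝟙_ _) ≫ extendApp f (m ⊗ 𝟙_ _) =
      (extendApp f m ⊗ₘ extendApp f (𝟙_ _)) ≫ μ H m (𝟙_ _)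
    rw [← cancel_mono (H.map (ρ_ m).hom), Category.assoc, Category.assoc, ← extendNatural f,
      ← cancel_epi (G.obj m ◁ ε G), ← right_unitality_assoc, ← id_tensorHom,
      tensorHom_comp_tensorHom_assoc, extendApp_unit, ε_η_assoc, Category.id_comp,
      MonoidalCategory.tensorHom_def, Category.assoc, ← right_unitality, rightUnitor_naturality]
  | succ k ih =>
    change μ G m (⟨k⟩ ⊗ ⟨1⟩) ≫ extendApp f (m ⊗ (⟨k⟩ ⊗ ⟨1⟩)) =
      (extendApp f m ⊗ₘ extendApp f (⟨k⟩ ⊗ ⟨1⟩)) ≫ μ H m (⟨k⟩ ⊗ ⟨1⟩)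
    rw [← cancel_epi (G.obj m ◁ μ G ⟨k⟩ ⟨1⟩), ← cancel_epi (α_ _ _ _).hom, ← associativity_assoc,
      extendNatural f, extendApp_tensor_one, extendApp_tensor_one, ← id_tensorHom,
      tensorHom_comp_tensorHom_assoc, Category.assoc, μ_δ_assoc, μ_δ_assoc,
      Category.id_comp, ← tensorHom_id,
      Category.assoc, tensorHom_comp_tensorHom_assoc, ih, Category.id_comp]
    have e₁ : (extendApp f m ⊗ₘ extendApp f ⟨k⟩) ≫ μ H m ⟨k⟩ ⊗ₘ f =
        ((extendApp f m ⊗ₘ extendApp f ⟨k⟩) ⊗ₘ f) ≫ μ H m ⟨k⟩ ▷ _ := by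
      rw [← tensorHom_id, tensorHom_comp_tensorHom, Category.comp_id]
    have e₂ : extendApp f m ⊗ₘ (extendApp f ⟨k⟩ ⊗ₘ f) ≫ μ H ⟨k⟩ ⟨1⟩ =
      (extendApp f m ⊗ₘ (extendApp f ⟨k⟩ ⊗ₘ f)) ≫ _ ◁ μ H ⟨k⟩ ⟨1⟩ := by
      rw [← id_tensorHom, tensorHom_comp_tensorHom, Category.comp_id]
    rw [e₁, e₂, Category.assoc, Category.assoc, associativity, associator_naturality_assoc]

theorem extend_isMonoidal : NatTrans.IsMonoidal (extend f) where
  unit := by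
    change ε G ≫ extendApp f (𝟙_ _) = _
    rw [extendApp_unit, ε_η_assoc]
  tensor m k := μ_extendApp f m k.n

/-- The left unitor of the object `1`, which is an identity. -/
theorem leftUnitor_one : (λ_ (⟨1⟩ : Niso)).hom = 𝟙 (⟨1⟩ : Niso) :=
  Niso.hom_ext fun _ => Subsingleton.elim (α := Fin 1) _ _

theorem extend_app_one : (extend f).app ⟨1⟩ = f := by
  have h : extendApp f (𝟙_ Niso ⊗ ⟨1⟩) ≫ H.map (λ_ (⟨1⟩ : Niso)).hom =
      G.map (λ_ (⟨1⟩ : Niso)).hom ≫ f := by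
    rw [← cancel_epi (μ G _ _), ← cancel_epi (ε G ▷ _), ← left_unitality_assoc,
      extendApp_tensor_one, extendApp_unit, Category.assoc, Category.assoc, μ_δ_assoc,
      ← tensorHom_id, tensorHom_comp_tensorHom_assoc, ε_η_assoc, Category.id_comp,
      MonoidalCategory.tensorHom_def', Category.assoc, ← left_unitality, leftUnitor_naturality]
  rw [leftUnitor_one] at h
  -- `𝟙 ⊗ 1` and `1` are the same object only up to unfolding
  erw [H.map_id, G.map_id, Category.id_comp, Category.comp_id] at h
  exact h

/-- A monoidal transformation is determined by its component at `1`. -/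
theorem monoidal_natTrans_ext {θ θ' : G ⟶ H} [NatTrans.IsMonoidal θ]
    [NatTrans.IsMonoidal θ'] (h : θ.app ⟨1⟩ = θ'.app ⟨1⟩) : θ = θ' := by
  ext ⟨n⟩
  induction n with
  | zero =>
    rw [← cancel_epi (ε G)]
    exact (NatTrans.IsMonoidal.unit (τ := θ)).trans (NatTrans.IsMonoidal.unit (τ := θ')).symm
  | succ n ih =>
    rw [← cancel_epi (μ G ⟨n⟩ ⟨1⟩)]
    refine (NatTrans.IsMonoidal.tensor (τ := θ) _ _).trans
      (Eq.trans ?_ (NatTrans.IsMonoidal.tensor (τ := θ') _ _).symm)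
    rw [h, ih]

end
namespace Qo

/-! ### Cocontinuous functors on presheaves -/

section

variable {A : Type v} [Category.{u} A]

theorem yhom_res {F : Qo.{u}} {m n : Niso} (f : m ⟶ n) (a : F.val (op n)) :
    yhom (res F f.op a) = y.map f ≫ yhom a :=
  y_ext (by rw [ap_yhom, ap_comp, ap_y_map, ap_res, ap_yhom])

theorem yhom_comp {F G : Qo.{u}} {n : Niso} (a : F.val (op n)) (g : F ⟶ G) :
    yhom a ≫ g = yhom (ap g a) :=
  y_ext (by rw [ap_comp, ap_yhom, ap_yhom])

theorem yhom_univ (n : Niso) : yhom (univ.{u} n) = 𝟙 _ :=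
  y_ext (by rw [ap_yhom, ap_id])

variable [HasColimits A] {L M : Qo.{u} ⥤ A} [PreservesColimits L]

/-- The maps `L h_n ⟶ L F`, for all elements of `F`, are jointly epimorphic. -/
theorem cocontinuous_ext {F : Qo.{u}} {Z : A} {s t : L.obj F ⟶ Z}
    (h : ∀ n (a : F.val (op n)), L.map (yhom a) ≫ s = L.map (yhom a) ≫ t) : s = t := by
  have := isLeftAdjoint_of_preservesColimits L
  let adj := Adjunction.ofIsLeftAdjoint L
  refine (adj.homEquiv _ _).injective (hom_ext' fun n a => ?_)
  have h' := congrArg (fun q => ap (adj.homEquiv _ _ q) (univ (unop n))) (h (unop n) a)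
  simp only [adj.homEquiv_naturality_left, ap_comp, ap_yhom] at h'
  exact h'

/-- `L F` is the colimit of the objects `L h_n`, indexed by the elements of `F`. -/
theorem exists_desc {F : Qo.{u}} {Z : A} (φ : ∀ n, F.val (op n) → (L.obj (y.obj n) ⟶ Z))
    (hφ : ∀ {m n} (f : m ⟶ n) a, φ m (res F f.op a) = L.map (y.map f) ≫ φ n a) :
    ∃ t : L.obj F ⟶ Z, ∀ n a, L.map (yhom a) ≫ t = φ n a := by
  have := isLeftAdjoint_of_preservesColimits L
  let adj := Adjunction.ofIsLeftAdjoint L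
  let t : F ⟶ L.rightAdjoint.obj Z := ⟨
    { app n := ↾fun a => ap (adj.homEquiv _ _ (φ (unop n) a)) (univ (unop n))
      naturality n n' f := ConcreteCategory.hom_ext _ _ fun a => by
        change ap (adj.homEquiv _ _ (φ (unop n') (res F f.unop.op a))) (univ (unop n')) =
          res _ f (ap (adj.homEquiv _ _ (φ (unop n) a)) (univ (unop n)))
        rw [hφ, adj.homEquiv_naturality_left, ap_comp, ap_y_map, ap_res]
        rfl }⟩
  refine ⟨(adj.homEquiv _ _).symm t, fun n a => ?_⟩
  rw [← adj.homEquiv_naturality_left_symm, Equiv.symm_apply_eq]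
  refine y_ext ?_
  rw [ap_comp, ap_yhom]
  rfl

theorem cocontinuous_natTrans_ext {τ τ' : L ⟶ M} (h : ∀ n, τ.app (y.obj n) = τ'.app (y.obj n)) :
    τ = τ' := by
  ext F
  refine cocontinuous_ext fun n a => ?_
  rw [τ.naturality, τ'.naturality, h]

/-- A transformation of the restrictions to the representable presheaves extends. -/
theorem exists_extension (σ : y ⋙ L ⟶ y ⋙ M) : ∃ τ : L ⟶ M, ∀ n, τ.app (y.obj n) = σ.app n := by
  choose τ hτ using fun F => exists_desc (L := L) (F := F) (Z := M.obj F)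
    (fun n a => σ.app n ≫ M.map (yhom a)) (fun {m n} f a => by
      rw [yhom_res, M.map_comp]
      exact (σ.naturality_assoc f _).symm)
  refine ⟨{ app := τ, naturality := fun F G g => cocontinuous_ext fun n a => ?_ }, fun n => ?_⟩
  · rw [reassoc_of% hτ, ← L.map_comp_assoc, yhom_comp, hτ, ← M.map_comp, yhom_comp]
  · have := hτ _ n (univ n)
    rw [yhom_univ, L.map_id, M.map_id, Category.id_comp] at this
    exact this.trans (Category.comp_id _)

/-- A transformation of cocontinuous functors is an isomorphism if it is one on the representable
presheaves. -/
theorem isIso_of_representable [PreservesColimits M] (τ : L ⟶ M)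
    (h : ∀ n, IsIso (τ.app (y.obj n))) :
    IsIso τ := by
  obtain ⟨τ', h'⟩ := exists_extension (L := M) (M := L)
    { app n := inv (τ.app (y.obj n))
      naturality m n f := by
        rw [IsIso.eq_inv_comp, Functor.comp_map, ← τ.naturality_assoc, IsIso.hom_inv_id,
          Category.comp_id]
        rfl }
  refine ⟨τ', cocontinuous_natTrans_ext fun n => ?_, cocontinuous_natTrans_ext fun n => ?_⟩
  · rw [NatTrans.comp_app, h']
    exact IsIso.hom_inv_id _
  · rw [NatTrans.comp_app, h']
    exact IsIso.inv_hom_id _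

variable [MonoidalCategory A] [SymmetricCategory A] [IsPrevectoid A]

instance (X : A) : PreservesColimits (tensorLeft X) := IsPrevectoid.preservesColimits_tensorLeft X
instance (X : A) : PreservesColimits (tensorRight X) := IsPrevectoid.preservesColimits_tensorRight X

/-- The maps `L h_m ⊗ L h_n ⟶ L F ⊗ L G`, for all elements of `F` and `G`, are jointly epimorphic.
-/
theorem cocontinuous_ext₂ {F G : Qo.{u}} {Z : A} {s t : L.obj F ⊗ L.obj G ⟶ Z}
    (h : ∀ m (a : F.val (op m)) n (b : G.val (op n)),
      (L.map (yhom a) ⊗ₘ L.map (yhom b)) ≫ s = (L.map (yhom a) ⊗ₘ L.map (yhom b)) ≫ t) : s = t := by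
  refine cocontinuous_ext (L := L ⋙ tensorRight (L.obj G)) fun m a => ?_
  refine cocontinuous_ext (L := L ⋙ tensorLeft (L.obj (y.obj m))) fun n b => ?_
  have := h m a n b
  rw [MonoidalCategory.tensorHom_def', Category.assoc, Category.assoc] at this
  exact this

/-- A transformation of cocontinuous `⊗`-functors is monoidal if this holds on the representable
presheaves. -/
theorem isMonoidal_of_representable {L M : Qo.{u} ⥤ A} [PreservesColimits L] [L.Monoidal]
    [M.Monoidal] (τ : L ⟶ M) [h : NatTrans.IsMonoidal (Functor.whiskerLeft y τ)] :
    NatTrans.IsMonoidal τ where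
  unit := by
    have := h.unit
    rw [Functor.LaxMonoidal.comp_ε, Functor.LaxMonoidal.comp_ε, Functor.whiskerLeft_app,
      Category.assoc, τ.naturality, ← Category.assoc] at this
    exact (cancel_mono _).1 this
  tensor F G := cocontinuous_ext₂ fun m a n b => by
    have := h.tensor m n
    rw [Functor.LaxMonoidal.comp_μ, Functor.LaxMonoidal.comp_μ, Functor.whiskerLeft_app,
      Functor.whiskerLeft_app, Functor.whiskerLeft_app, Category.assoc, τ.naturality,
      ← Category.assoc, ← Category.assoc] at this
    have h' := (cancel_mono _).1 this
    rw [Functor.LaxMonoidal.μ_natural_assoc, τ.naturality, reassoc_of% h',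
      tensorHom_comp_tensorHom_assoc, τ.naturality, τ.naturality, ← tensorHom_comp_tensorHom_assoc,
      Functor.LaxMonoidal.μ_natural]
end
end Qo

/-! ### The functor given by the explicit formula -/

section
open Qo

variable {A : Type v} [Category.{u} A] [MonoidalCategory A] [SymmetricCategory A] [HasColimits A]
  (X : A)

/-- The functor `F ↦ ∐_n (F_n ⊗ X^{⊗n}) / S_n`, for the action `powAction X`. -/
noncomputable abbrev explicit : Qo.{u} ⥤ A := explicitFunctor (powAction X)

variable {X} {F G H : Qo.{u}} {m n : Niso}

/-- The projection of `F_n ⊗ X^{⊗n}` to its quotient by the diagonal action. -/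
noncomputable def quotientπ (F : Qo.{u}) (n : ℕ) :
    copower X F n ⟶ Vectoids.quotient (powAction X) F n :=
  colimit.ι (SingleObj.functor (diagonalAct (powAction X) F n)) (SingleObj.star _)

theorem diagonalAct_quotientπ (n : ℕ) (σ : Equiv.Perm (Fin n)) :
    (diagonalAct (powAction X) F n σ : copower X F n ⟶ copower X F n) ≫ quotientπ F n =
      quotientπ F n :=
  colimit.w (SingleObj.functor (diagonalAct (powAction X) F n))
    (show SingleObj.star _ ⟶ SingleObj.star _ from σ)

theorem ι_diagonalAct {n : ℕ} (a : F.level n) (σ : Equiv.Perm (Fin n)) :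
    Sigma.ι (fun _ : F.level n => tensorPow X n) a ≫
      (diagonalAct (powAction X) F n σ : copower X F n ⟶ copower X F n) =
      powMap X n n σ ≫ Sigma.ι (fun _ : F.level n => tensorPow X n) (F.rightAct a σ⁻¹) :=
  Sigma.ι_desc _ _

/-- The map of `X^{⊗n}` to the copy number `a` of `X^{⊗n}` in `∐_n (F_n ⊗ X^{⊗n}) / S_n`. -/
noncomputable def inclLevel {n : ℕ} (a : F.level n) :
    tensorPow X n ⟶ ∐ fun n : ℕ => Vectoids.quotient (powAction X) F n :=
  Sigma.ι (fun _ : F.level n => tensorPow X n) a ≫ quotientπ F n ≫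
    Sigma.ι (fun n : ℕ => Vectoids.quotient (powAction X) F n) n

/-- The map `inclLevel`, for the objects of `Niso`. -/
noncomputable def incl (a : F.val (op m)) : (powFunctor X).obj m ⟶ (explicit X).obj F :=
  inclLevel (n := m.n) a

theorem inclLevel_rightAct {n : ℕ} (a : F.level n) (σ : Equiv.Perm (Fin n)) :
    inclLevel (F.rightAct a σ) = powMap X n n σ ≫ inclLevel a := by
  have h := ι_diagonalAct (X := X) (F.rightAct a σ) σ
  rw [← rightAct_mul, mul_inv_cancel, rightAct_one] at h
  rw [inclLevel, inclLevel, ← reassoc_of% h, reassoc_of% diagonalAct_quotientπ]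

/-- Elements in the same orbit of a symmetric group give the same copy of the tensor power in the
quotient, up to the action. -/
theorem incl_res (f : m ⟶ n) (a : F.val (op n)) :
    incl (res F f.op a) = (powFunctor X).map f ≫ incl a := by
  obtain ⟨m⟩ := m
  obtain ⟨n⟩ := n
  obtain ⟨σ⟩ := f
  obtain rfl : m = n := by simpa using Fintype.card_congr σ
  exact inclLevel_rightAct a σ

theorem incl_map (a : F.val (op m)) (g : F ⟶ G) :
    incl a ≫ (explicit X).map g = incl (ap g a) := by
  have h (n : ℕ) : quotientπ (X := X) F n ≫ colimMap (diagonalActMap (powAction X) g n) =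
      copowerMap X g n ≫ quotientπ G n := ι_colimMap _ _
  have h' (a : F.level m.n) : inclLevel a ≫
      Limits.Sigma.map (fun n => colimMap (diagonalActMap (powAction X) g n)) =
      inclLevel (g.natTrans.app (op m) a) := by
    rw [inclLevel, Category.assoc, Category.assoc, Limits.Sigma.ι_map, reassoc_of% h, copowerMap,
      Sigma.ι_desc_assoc]
    rfl
  exact h' a

theorem explicit_ext {Y : A} {s t : (explicit X).obj F ⟶ Y}
    (h : ∀ m (a : F.val (op m)), incl a ≫ s = incl a ≫ t) : s = t := by
  refine Sigma.hom_ext _ _ fun n => colimit.hom_ext fun _ => Sigma.hom_ext _ _ fun a => ?_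
  have h' (q : (∐ fun n : ℕ => Vectoids.quotient (powAction X) F n) ⟶ Y) : inclLevel a ≫ q =
    Sigma.ι (fun _ : F.level n => tensorPow X n) a ≫ quotientπ F n ≫
    Sigma.ι (fun n : ℕ => Vectoids.quotient (powAction X) F n) n ≫ q := by
      simp only [inclLevel, Category.assoc]
  exact (h' s).symm.trans ((h ⟨n⟩ a).trans (h' t))

/-- The presheaf `n ↦ Hom(X^{⊗n}, Y)`. -/
def homPresheaf (X Y : A) : Qo.{u} where
  functor := (powFunctor X).op ⋙ yoneda.obj Y

/-- The map of `X^{⊗n}` which is the value of a map to `homPresheaf X Y` at an element. -/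
def levelHom {Y : A} (φ : F ⟶ homPresheaf X Y) {n : ℕ} (a : F.level n) : tensorPow X n ⟶ Y :=
  ap (x := op (⟨n⟩ : Niso)) φ a

theorem levelHom_rightAct {Y : A} (φ : F ⟶ homPresheaf X Y) {n : ℕ} (a : F.level n)
    (σ : Equiv.Perm (Fin n)) :
    levelHom φ (F.rightAct a σ) = powMap X n n σ ≫ levelHom φ a :=
  ap_res φ (Quiver.Hom.op (⟨σ⟩ : (⟨n⟩ : Niso) ⟶ ⟨n⟩)) a

theorem diagonalAct_desc {Y : A} (φ : F ⟶ homPresheaf X Y) {n : ℕ} (σ : Equiv.Perm (Fin n)) :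
    (diagonalAct (powAction X) F n σ : copower X F n ⟶ copower X F n) ≫
      Limits.Sigma.desc (levelHom φ) = Limits.Sigma.desc (levelHom φ) := by
  refine Sigma.hom_ext _ _ fun a => ?_
  have h := levelHom_rightAct φ (F.rightAct a σ⁻¹) σ
  rw [← rightAct_mul, inv_mul_cancel, rightAct_one] at h
  rw [reassoc_of% ι_diagonalAct, Sigma.ι_desc, Sigma.ι_desc, h]

/-- A map out of `∐_n (F_n ⊗ X^{⊗n}) / S_n`, given by compatible maps on the copies of the tensor
powers. -/
noncomputable def explicitDesc {Y : A} (φ : F ⟶ homPresheaf X Y) : (explicit X).obj F ⟶ Y :=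
  Limits.Sigma.desc fun n => colimit.desc (SingleObj.functor (diagonalAct (powAction X) F n))
    { pt := Y
      ι :=
        { app _ := Limits.Sigma.desc (levelHom φ)
          naturality _ _ σ := (diagonalAct_desc φ σ).trans (Category.comp_id _).symm } }

theorem incl_explicitDesc {Y : A} (φ : F ⟶ homPresheaf X Y) (a : F.val (op m)) :
    incl a ≫ explicitDesc φ = ap φ a := by
  have h (n : ℕ) (c) : quotientπ (X := X) F n ≫ colimit.desc _ c = c.ι.app (SingleObj.star _) :=
    colimit.ι_desc _ _
  have h' (a : F.level m.n) (q) : inclLevel a ≫ Limits.Sigma.desc q =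
      Sigma.ι (fun _ : F.level m.n => tensorPow X m.n) a ≫ quotientπ F m.n ≫
        (q m.n : _ ⟶ Y) := by
    rw [inclLevel, Category.assoc, Category.assoc, Limits.Sigma.ι_desc]
  refine (h' a _).trans ?_
  rw [h]
  exact Limits.Sigma.ι_desc _ _

/-- The adjunction between the explicit functor and `homPresheaf X`. -/
noncomputable def explicitHomEquiv (F : Qo.{u}) (Y : A) :
    ((explicit X).obj F ⟶ Y) ≃ (F ⟶ homPresheaf X Y) where
  toFun t := ⟨
    { app x := ↾fun a => incl (m := x.unop) a ≫ t
      naturality _ _ f := ConcreteCategory.hom_ext _ _ fun a =>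
        (congrArg (fun q => q ≫ t) (incl_res f.unop a)).trans (Category.assoc _ _ _) }⟩
  invFun := explicitDesc
  left_inv _ := explicit_ext fun _ a => incl_explicitDesc _ a
  right_inv φ := hom_ext' fun x a => incl_explicitDesc (m := x.unop) φ a

instance : (explicit X).IsLeftAdjoint :=
  (Adjunction.adjunctionOfEquivRight (F := explicit X) explicitHomEquiv fun _ _ _ f g =>
    hom_ext' fun x a => (reassoc_of% (incl_map (m := x.unop) a f)) g).isLeftAdjoint

instance : PreservesColimits (explicit X) :=
  (Adjunction.ofIsLeftAdjoint (explicit X)).leftAdjoint_preservesColimits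

end

/-! ### The tensor structure of the explicit functor -/

namespace Qo

variable {F G H K : Qo.{u}} {m n k : Niso}

/-- The element `a ⊗ b`, at an object of the form `op (m ⊗ n)`. The identities for `tmul` hold for
it unchanged, with the structure of `Niso` in place of that of `Nisoᵒᵖ`. -/
noncomputable def tmulOp (a : F.val (op m)) (b : G.val (op n)) : (F ⊗ G).val (op (m ⊗ n)) :=
  tmul a b

/-- The canonical element of the unit object, at the object `op 𝟙`. -/
noncomputable def oneOp : (𝟙_ Qo.{u}).val (op (𝟙_ Niso)) := one

theorem ap_associator_tmulOp (a : F.val (op m)) (b : G.val (op n)) (c : H.val (op k)) :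
    ap (α_ F G H).hom (tmulOp (tmulOp a b) c) =
      res (F ⊗ (G ⊗ H)) (α_ m n k).hom.op (tmulOp a (tmulOp b c)) := ap_associator a b c

theorem ap_leftUnitor_inv_op (a : F.val (op m)) :
    ap (λ_ F).inv a = res _ (λ_ m).inv.op (tmulOp oneOp a) := ap_leftUnitor_inv a

theorem ap_rightUnitor_inv_op (a : F.val (op m)) :
    ap (ρ_ F).inv a = res _ (ρ_ m).inv.op (tmulOp a oneOp) := ap_rightUnitor_inv a

theorem ap_braiding_tmulOp (a : F.val (op m)) (b : G.val (op n)) :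
    ap (β_ F G).hom (tmulOp a b) = res (G ⊗ F) (β_ m n).hom.op (tmulOp b a) := ap_braiding a b

theorem ap_whiskerLeft_tmulOp (f : G ⟶ K) (a : F.val (op m)) (b : G.val (op n)) :
    ap (F ◁ f) (tmulOp a b) = tmulOp a (ap f b) := ap_whiskerLeft f a b

theorem ap_whiskerRight_tmulOp (f : F ⟶ K) (a : F.val (op m)) (b : G.val (op n)) :
    ap (f ▷ G) (tmulOp a b) = tmulOp (ap f a) b := ap_whiskerRight f a b

/-- A morphism out of a triple Day convolution is determined by its values at the elements `(a ⊗
b) ⊗ c`. The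
first factor is split off by currying. -/
theorem tensor_ext₃ {f g : (F ⊗ G) ⊗ H ⟶ K}
    (h : ∀ m n k (a : F.val (op m)) (b : G.val (op n)) (c : H.val (op k)),
      ap f (tmulOp (tmulOp a b) c) = ap g (tmulOp (tmulOp a b) c)) : f = g := by
  rw [← cancel_epi (α_ F G H).inv]
  refine (tensorHomEquiv _ _ _).injective (tensor_ext fun y z b c => ihom_ext fun x a => ?_)
  have h' : ap (α_ F G H).inv (tmul a (tmul b c)) = res _ (α_ x y z).hom (tmul (tmul a b) c) := by
    have := congrArg (fun t => ap (α_ F G H).inv (res _ (α_ x y z).hom t)) (ap_associator a b c)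
    simp only [← res_comp, Iso.inv_hom_id, res_id] at this
    rw [← this, ap_res, ← ap_comp, Iso.hom_inv_id, ap_id]
  change ap ((α_ F G H).inv ≫ f) (tmul a (tmul b c)) = ap ((α_ F G H).inv ≫ g) (tmul a (tmul b c))
  rw [ap_comp, ap_comp, h', ap_res, ap_res]
  exact congrArg _ (h x.unop y.unop z.unop a b c)

end Qo

section
open Qo
open Functor.OplaxMonoidal
open Functor.LaxMonoidal (ε μ)

variable {A : Type v} [Category.{u} A] [MonoidalCategory A] [SymmetricCategory A] [HasColimits A]
  {X : A} {F G H : Qo.{u}} {m n : Niso}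

theorem explicit_tensor_ext {Y : A} {s t : (explicit X).obj (F ⊗ G) ⟶ Y}
    (h : ∀ m n (a : F.val (op m)) (b : G.val (op n)),
      incl (tmulOp a b) ≫ s = incl (tmulOp a b) ≫ t) : s = t :=
  (explicitHomEquiv _ _).injective (tensor_ext fun x y a b => h x.unop y.unop a b)

theorem explicit_tensor_ext₃ {Y : A} {s t : (explicit X).obj ((F ⊗ G) ⊗ H) ⟶ Y}
    (h : ∀ m n k (a : F.val (op m)) (b : G.val (op n)) (c : H.val (op k)),
      incl (tmulOp (tmulOp a b) c) ≫ s = incl (tmulOp (tmulOp a b) c) ≫ t) : s = t :=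
  (explicitHomEquiv _ _).injective (tensor_ext₃ h)

theorem explicit_unit_ext {Y : A} {s t : (explicit X).obj (𝟙_ Qo.{u}) ⟶ Y}
    (h : incl oneOp ≫ s = incl oneOp ≫ t) : s = t :=
  (explicitHomEquiv _ _).injective (unit_ext h)

theorem incl_tensorHom_naturality {m' n' : Niso} (f : m ⟶ m') (g : n ⟶ n') (a : F.val (op m'))
    (b : G.val (op n')) : δ (powFunctor X) m n ≫ (incl (res F f.op a) ⊗ₘ incl (res G g.op b)) =
      (powFunctor X).map (f ⊗ₘ g) ≫ δ (powFunctor X) m' n' ≫ (incl a ⊗ₘ incl b) := by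
  rw [incl_res, incl_res, ← tensorHom_comp_tensorHom, δ_natural_assoc]

/-- The comparison map `Φ (F ⊗ G) ⟶ Φ F ⊗ Φ G` of the explicit functor `Φ`. On the copy of
`X^{⊗(m+n)}` with the number `a ⊗ b` it is `X^{⊗(m+n)} ≅ X^{⊗m} ⊗ X^{⊗n}`, followed by the
inclusions of the copies number `a` and `b`. -/
noncomputable def explicitδ (X : A) (F G : Qo.{u}) :
    (explicit X).obj (F ⊗ G) ⟶ (explicit X).obj F ⊗ (explicit X).obj G :=
  explicitDesc (lift
    (fun x y a b => δ (powFunctor X) x.unop y.unop ≫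
      (incl (m := x.unop) a ⊗ₘ incl (m := y.unop) b))
    (fun f g a b => incl_tensorHom_naturality f.unop g.unop a b))

theorem incl_explicitδ (a : F.val (op m)) (b : G.val (op n)) :
    incl (tmulOp a b) ≫ explicitδ X F G = δ (powFunctor X) m n ≫ (incl a ⊗ₘ incl b) :=
  (incl_explicitDesc _ _).trans (ap_lift _ _ a b)

/-- A map out of a tensor power of `X`, as an element of `homPresheaf X Y`. -/
def homElement {Y : A} (t : (powFunctor X).obj m ⟶ Y) : (homPresheaf.{u} X Y).val (op m) := t

/-- The comparison map `Φ 𝟙 ⟶ 𝟙`. -/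
noncomputable def explicitη (X : A) : (explicit X).obj (𝟙_ Qo.{u}) ⟶ 𝟙_ A :=
  explicitDesc (yε ≫ yhom (homElement (η (powFunctor X))))

theorem incl_explicitη : incl oneOp ≫ explicitη X = η (powFunctor X) := by
  refine (incl_explicitDesc _ _).trans ?_
  have h : ap yε.{u} oneOp = univ (𝟙_ Niso) := ap_yε
  rw [ap_comp, h, ap_yhom]
  rfl

theorem comp_tensorHom_right {C : Type*} [Category* C] [MonoidalCategory C] {X X' X'' Z Z' : C}
    (f : X ⟶ X') (g : X' ⟶ X'') (h : Z ⟶ Z') : (f ≫ g) ⊗ₘ h = f ▷ Z ≫ (g ⊗ₘ h) := by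
  rw [← tensorHom_id, tensorHom_comp_tensorHom, Category.id_comp]

theorem tensorHom_comp_left {C : Type*} [Category* C] [MonoidalCategory C] {X X' X'' Z Z' : C}
    (f : X ⟶ X') (g : X' ⟶ X'') (h : Z ⟶ Z') : h ⊗ₘ (f ≫ g) = Z ◁ f ≫ (h ⊗ₘ g) := by
  rw [← id_tensorHom, tensorHom_comp_tensorHom, Category.id_comp]

/-- The oplax monoidal structure of the explicit functor. -/
@[reducible]
noncomputable def explicitOplaxMonoidal (X : A) : (explicit X).OplaxMonoidal where
  η := explicitη X
  δ := explicitδ X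
  δ_natural_left f G := explicit_tensor_ext fun m n a b => by
    rw [reassoc_of% incl_explicitδ, reassoc_of% incl_map, ap_whiskerRight_tmulOp, incl_explicitδ,
      ← tensorHom_id, tensorHom_comp_tensorHom, incl_map, Category.comp_id]
  δ_natural_right F g := explicit_tensor_ext fun m n a b => by
    rw [reassoc_of% incl_explicitδ, reassoc_of% incl_map, ap_whiskerLeft_tmulOp, incl_explicitδ,
      ← id_tensorHom, tensorHom_comp_tensorHom, incl_map, Category.comp_id]
  oplax_associativity F G H := explicit_tensor_ext₃ fun m n k a b c => by
    rw [reassoc_of% incl_explicitδ, reassoc_of% incl_map, ap_associator_tmulOp, incl_res,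
      Category.assoc,
      reassoc_of% incl_explicitδ, ← tensorHom_id, ← id_tensorHom, tensorHom_comp_tensorHom_assoc,
      tensorHom_comp_tensorHom, incl_explicitδ, incl_explicitδ, Category.comp_id, Category.comp_id]
    rw [comp_tensorHom_right, tensorHom_comp_left, Category.assoc, associator_naturality,
      associativity_assoc]
  oplax_left_unitality F := explicit_ext fun m a => by
    rw [reassoc_of% incl_map, ap_leftUnitor_inv_op, incl_res, Category.assoc,
      reassoc_of% incl_explicitδ,
      ← tensorHom_id, tensorHom_comp_tensorHom, incl_explicitη, Category.comp_id]
    rw [MonoidalCategory.tensorHom_def, ← left_unitality_assoc, leftUnitor_inv_naturality]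
  oplax_right_unitality F := explicit_ext fun m a => by
    rw [reassoc_of% incl_map, ap_rightUnitor_inv_op, incl_res, Category.assoc,
      reassoc_of% incl_explicitδ,
      ← id_tensorHom, tensorHom_comp_tensorHom, incl_explicitη, Category.comp_id]
    rw [MonoidalCategory.tensorHom_def', ← right_unitality_assoc, rightUnitor_inv_naturality]

theorem explicitδ_braiding (F G : Qo.{u}) :
    explicitδ X F G ≫ (β_ _ _).hom = (explicit X).map (β_ F G).hom ≫ explicitδ X G F :=
  explicit_tensor_ext fun m n a b => by
    have h : δ (powFunctor X) m n ≫ (β_ _ _).hom =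
        (powFunctor X).map (β_ m n).hom ≫ δ (powFunctor X) n m := by
      rw [Functor.map_braiding, Category.assoc, Category.assoc, Functor.Monoidal.μ_δ,
        Category.comp_id]
    rw [reassoc_of% incl_explicitδ, reassoc_of% incl_map, ap_braiding_tmulOp, incl_res,
      Category.assoc,
      incl_explicitδ, BraidedCategory.braiding_naturality, reassoc_of% h]

/-- The value of the explicit functor at a representable presheaf is a tensor power. -/
noncomputable def explicitY (X : A) (n : Niso) :
    (powFunctor X).obj n ≅ (explicit X).obj (y.obj n) where
  hom := incl (univ n)
  inv := explicitDesc (yhom (homElement (𝟙 _)))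
  hom_inv_id := (incl_explicitDesc _ _).trans (ap_yhom _)
  inv_hom_id := by
    refine explicit_ext fun m a => ?_
    have h : incl (univ n) ≫ explicitDesc (X := X) (yhom (homElement (𝟙 _))) = 𝟙 _ :=
      (incl_explicitDesc _ _).trans (ap_yhom _)
    have ha := eq_res_toHom a
    generalize toHom a = f at ha
    subst ha
    refine Eq.trans ?_ (Category.comp_id _).symm
    refine (congrArg (fun t => t ≫ _) (incl_res f (univ n))).trans ?_
    rw [Category.assoc, reassoc_of% h]
    exact (incl_res f (univ n)).symm

/-- For representable presheaves the comparison map is the isomorphism `X^{⊗(m+n)} ≅ X^{⊗m} ⊗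
X^{⊗n}`. -/
theorem isIso_explicitδ_y (m n : Niso) : IsIso (explicitδ X (y.obj m) (y.obj n)) := by
  have h : (explicitY X (m ⊗ n)).hom ≫ (explicit X).map (yδ m n) ≫ explicitδ X _ _ =
      δ (powFunctor X) m n ≫ ((explicitY X m).hom ⊗ₘ (explicitY X n).hom) := by
    refine ((reassoc_of% (incl_map (X := X) (univ (m ⊗ n)) (yδ m n))) _).trans ?_
    rw [ap_yδ]
    exact incl_explicitδ _ _
  have : IsIso ((explicitY X (m ⊗ n)).hom ≫ (explicit X).map (yδ m n) ≫ explicitδ X _ _) := by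
    rw [h]
    infer_instance
  have := IsIso.of_isIso_comp_left (explicitY X (m ⊗ n)).hom
    ((explicit X).map (yδ m n) ≫ explicitδ X _ _)
  exact IsIso.of_isIso_comp_left ((explicit X).map (yδ m n)) _

instance : IsIso (explicitη X) := by
  refine ⟨ε (powFunctor X) ≫ incl oneOp, ?_, ?_⟩
  · refine explicit_unit_ext ?_
    rw [reassoc_of% incl_explicitη, Functor.Monoidal.η_ε_assoc, Category.comp_id]
  · rw [Category.assoc, incl_explicitη, Functor.Monoidal.ε_η]

end

section
open Qo

variable {A : Type v} [Category.{u} A] [MonoidalCategory A] [SymmetricCategory A] [IsPrevectoid A]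
  (X : A)

/-- Both sides of the comparison map are cocontinuous in both variables, and it is an isomorphism
for representable presheaves. -/
instance (F G : Qo.{u}) : IsIso (explicitδ X F G) := by
  let := explicitOplaxMonoidal X
  let L (F : Qo.{u}) : tensorLeft F ⋙ explicit X ⟶ explicit X ⋙ tensorLeft ((explicit X).obj F) :=
    { app G := explicitδ X F G
      naturality _ _ g := (Functor.OplaxMonoidal.δ_natural_right (explicit X) F g).symm }
  let R (G : Qo.{u}) : tensorRight G ⋙ explicit X ⟶ explicit X ⋙ tensorRight ((explicit X).obj G) :=
    { app F := explicitδ X F G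
      naturality _ _ f := (Functor.OplaxMonoidal.δ_natural_left (explicit X) f G).symm }
  have h (m : Niso) : IsIso (L (y.obj m)) := isIso_of_representable _ (isIso_explicitδ_y m)
  have h' : IsIso (R G) := isIso_of_representable _ fun m =>
    (NatTrans.isIso_iff_isIso_app _).1 (h m) G
  exact (NatTrans.isIso_iff_isIso_app _).1 h' F

noncomputable instance : (explicit X).Monoidal :=
  letI := explicitOplaxMonoidal X
  haveI : IsIso (Functor.OplaxMonoidal.η (explicit X)) := inferInstanceAs (IsIso (explicitη X))
  haveI (F G : Qo.{u}) : IsIso (Functor.OplaxMonoidal.δ (explicit X) F G) :=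
    inferInstanceAs (IsIso (explicitδ X F G))
  .ofOplaxMonoidal _

theorem δ_explicit (F G : Qo.{u}) :
    Functor.OplaxMonoidal.δ (explicit X) F G = explicitδ X F G := rfl

noncomputable instance : (explicit X).Braided where
  braided F G := by
    rw [← cancel_epi (Functor.OplaxMonoidal.δ (explicit X) F G), Functor.Monoidal.δ_μ_assoc,
      ← cancel_mono (Functor.OplaxMonoidal.δ (explicit X) G F), Category.assoc, Category.assoc,
      Functor.Monoidal.μ_δ, Category.comp_id, δ_explicit, δ_explicit, explicitδ_braiding]

/-- The explicit functor takes the universal object to `X`. -/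
noncomputable def explicitXo : (explicit X).obj Xo.{u} ≅ X :=
  (explicitY X ⟨1⟩).symm ≪≫ powSucc X 0 ≪≫ whiskerRightIso (powZero X) X ≪≫ λ_ X

end

/-! ### Evaluation at the universal object -/

section
open Qo

variable {A : Type v} [Category.{u} A] [MonoidalCategory A] [SymmetricCategory A] [IsPrevectoid A]

/-- A morphism from a cocontinuous `⊗`-functor on `Qo` to a `⊗`-functor amounts to a map between
their values at the universal object. It is determined by its restriction to the representable
presheaves, which is a transformation of symmetric monoidal functors on `Niso`. -/
theorem eval_bijective (L M : TensorFunctor Qo.{u} A) [PreservesColimits L.functor] :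
    Function.Bijective fun θ : L ⟶ M => θ.natTrans.app Xo.{u} := by
  constructor
  · intro θ θ' h
    refine TensorFunctor.Hom.ext (cocontinuous_natTrans_ext fun n => ?_)
    have : Functor.whiskerLeft y θ.natTrans = Functor.whiskerLeft y θ'.natTrans :=
      monoidal_natTrans_ext h
    exact congrArg (fun t => t.app n) this
  · intro f
    obtain ⟨τ, hτ⟩ := exists_extension (L := L.functor) (M := M.functor)
      (extend (G := y ⋙ L.functor) (H := y ⋙ M.functor) f)
    have h : Functor.whiskerLeft y τ = extend (G := y ⋙ L.functor) (H := y ⋙ M.functor) f :=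
      NatTrans.ext (funext hτ)
    have : NatTrans.IsMonoidal (Functor.whiskerLeft y τ) := by
      rw [h]
      exact extend_isMonoidal (G := y ⋙ L.functor) (H := y ⋙ M.functor) f
    exact ⟨⟨τ, isMonoidal_of_representable τ⟩,
      (hτ ⟨1⟩).trans (extend_app_one (G := y ⋙ L.functor) (H := y ⋙ M.functor) f)⟩

/-- The explicit functor, as a cocontinuous `⊗`-functor. -/
noncomputable def explicitTensorFunctor (X : A) : CocontTensorFunctor Qo.{u} A where
  functor := explicit X
  braided := inferInstance
  cocontinuous := inferInstance

instance : (CocontTensorFunctor.eval A Xo.{u}).IsEquivalence where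
  faithful := ⟨fun {L M} _ _ h =>
    have := L.cocontinuous
    (eval_bijective L.toTensorFunctor M.toTensorFunctor).injective h⟩
  full := ⟨fun {L M} f =>
    have := L.cocontinuous
    (eval_bijective L.toTensorFunctor M.toTensorFunctor).surjective f⟩
  essSurj := ⟨fun X => ⟨explicitTensorFunctor X, ⟨explicitXo X⟩⟩⟩

instance : (VectoidHom.inverseImageOf A Xo.{u}).IsEquivalence where
  faithful := ⟨fun {f g} _ _ h =>
    have := f.adjunction.leftAdjoint_preservesColimits
    (eval_bijective f.inverseImage g.inverseImage).injective h⟩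
  full := ⟨fun {f g} t =>
    have := f.adjunction.leftAdjoint_preservesColimits
    (eval_bijective f.inverseImage g.inverseImage).surjective t⟩
  essSurj := ⟨fun X => ⟨⟨⟨explicit X, inferInstance⟩, _, .ofIsLeftAdjoint (explicit X)⟩,
    ⟨explicitXo X⟩⟩⟩

end
end Vectoids

theorem mainTheorem3 :
    IsObjectClassifier.{u, v, u + 1} Qo.{u} Xo.{u} ∧
    ∀ (A : Type v) [Category.{u} A] [MonoidalCategory A] [SymmetricCategory A] [IsVectoid A],
      (CocontTensorFunctor.eval A Xo.{u}).IsEquivalence ∧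
      ∀ X : A, ∃ (ρ : PermutationAction X) (Φ : CocontTensorFunctor Qo.{u} A)
        (e : Φ.functor.obj Xo.{u} ≅ X),
        (∀ ρ' : PermutationAction X, ρ' = ρ) ∧
        (∀ (Ψ : CocontTensorFunctor Qo.{u} A) (e' : Ψ.functor.obj Xo.{u} ≅ X),
          ∃! θ : Φ ≅ Ψ, (CocontTensorFunctor.eval A Xo.{u}).map θ.hom ≫ e'.hom = e.hom) ∧
        Nonempty (Φ.functor ≅ explicitFunctor ρ) := by
  refine ⟨⟨inferInstance, fun A _ _ _ _ => inferInstance⟩,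
    fun A _ _ _ _ => ⟨inferInstance, fun X => ?_⟩⟩
  refine ⟨powAction X, explicitTensorFunctor X, explicitXo X, eq_powAction X, fun Ψ e' => ?_,
    ⟨Iso.refl _⟩⟩
  let ev := CocontTensorFunctor.eval A Xo.{u}
  let t : ev.obj (explicitTensorFunctor X) ≅ ev.obj Ψ := explicitXo X ≪≫ e'.symm
  refine ⟨ev.preimageIso t, ?_, fun θ hθ => ?_⟩
  · change ev.map (ev.preimageIso t).hom ≫ e'.hom = (explicitXo X).hom
    rw [Functor.preimageIso_hom, Functor.map_preimage]
    exact ((Iso.comp_inv_eq e').1 rfl).symm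
  · refine Iso.ext (ev.map_injective ?_)
    rw [Functor.preimageIso_hom, Functor.map_preimage]
    exact (Iso.eq_comp_inv e').2 hθ
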